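/- Let $\mathcal H$ be a complex Hilbert space of dimension $M\in\mathbb N\cup\{+\infty\}$ and let $k\mapsto H(k)$, $k\in\mathbb R^3$, be a $\mathbb Z^3$-periodic, real-analytic family of self-adjoint operators on $\mathcal H$, uniformly bounded below. Here "real-analytic" means that, for some real $\lambda\le\inf_k\inf\operatorname{spec}H(k)$, the resolvents $(H(k)-\lambda)^{-1}$ exist as bounded operators and depend real-analytically on $k$ (for bounded $H(k)$, in particular if $M<\infty$, this is analyticity of $H$ itself). If $M=\infty$, assume moreover that for each $k$ the resolvent is compact, or that $H(k)$ has an orthonormal basis of eigenvectors listed by increasing eigenvalues. Let $\varepsilon_1(k)\le\varepsilon_2(k)\le\cdots$ be the eigenvalues of $H(k)$ counted with multiplicity, with the conventions $\varepsilon_0=-\infty$ and $\varepsilon_n=+\infty$ for $n>M$. Let $\mathcal B=\mathbb R^3/\mathbb Z^3$, for $n\ge1$ let $K_n=\{k\in\mathcal B:\varepsilon_n(k)=\varepsilon_{n+1}(k)\}$ (empty if $n\geq M$), and for $k\notin K_n$ let $P_n(k)$ be the orthogonal projector onto the span of the eigenvectors of the $n$ lowest eigenvalues. A point $k_0\in K_n$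 is a Weyl point of $K_n$ (a conical crossing of two eigenvalues) if $\varepsilon_{n-1}(k_0)<\varepsilon_n(k_0)=\varepsilon_{n+1}(k_0)<\varepsilon_{n+2}(k_0)$ and $\varepsilon_{n+1}(k)-\varepsilon_n(k)\ge c\,|k-k_0|$ near $k_0$ for some $c>0$. "Projector" means orthogonal projector. Let $N\ge 1$ and suppose that $K_N$ contains a Weyl point $k_0$. Then: 1. $\mathcal B\setminus K_{N+1}$ is open, $P_{N+1}$ is a real-analytic projector of rank $N+1$ on it, and $\operatorname{Ran}P_N\subset\operatorname{Ran}P_{N+1}$ wherever both are defined. 2. Let $U$ be an open set containing $k_0$ and $P$ a real-analytic family of projectors of rank $N+1$ on $U$ with $\operatorname{Ran}P_N(k)\subset\operatorname{Ran}P(k)$ for $k\notin K_N$ near $k_0$. Then $P=P_{N+1}$ on the connected component of $U\setminus K_{N+1}$ containing $k_0$. 3. Assume that $K_{N+1}$ is a finite union of points and piecewise smooth curves. If $P$ is a real-analytic family of projectors of rank $N+1$ on $\mathcal B$ with $\operatorname{Ran}P_N\subset\operatorname{Ran}P$ on $V\setminus K_N$ for some neighbourhood $V$ of $K_N$, then $P=P_{N+1}$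 on $\mathcal B\setminus K_{N+1}$. 4. Assume that $K_{N+1}$ is a finite union of points and piecewise smooth curves and that it contains a point across which $P_{N+1}$ has no real-analytic extension. Then there is no real-analytic family $P$ of projectors of rank $N+1$ on $\mathcal B$ with $\operatorname{Ran}P_N\subset\operatorname{Ran}P$ on $\mathcal B\setminus K_N$. Moreover there are no $N+1$ exponentially localised Wannier functions representing the first $N$ bands: there are no $w_1,\dots,w_{N+1}:\mathbb Z^3\to\mathcal H$ with $\|w_j(\gamma)\|\le C_je^{-a_j|\gamma|}$, $a_j>0$, such that the Bloch transforms $\phi_j(k)=\sum_{\gamma\in\mathbb Z^3}e^{2\pi i k\cdot\gamma}w_j(\gamma)$ are orthonormal for every $k$ and $\operatorname{Ran}P_N(k)\subset\operatorname{Span}(\phi_1(k),\dots,\phi_{N+1}(k))$ for all $k\notin K_N$. 5. The projector $P_{N+1}$ has no real-analytic extension across any Weyl point of $K_{N+1}$; so the conclusion of 4 holds when $K_{N+1}$ is a finite union of points and piecewise smooth curves that contains a Weyl point. -/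

import Mathlib

open Filter Topology

noncomputable section

/-- Momentum space `ℝ³`. The Brillouin zone is `ℝ³ / ℤ³`; objects on it are `ℤ³`-periodic objects
on `ℝ³`. -/
abbrev KSpace : Type := EuclideanSpace ℝ (Fin 3)

/-- The vector of `ℝ³` with the integer coordinates `g`. -/
def latticeVec (g : Fin 3 → ℤ) : KSpace := WithLp.toLp 2 (fun i => (g i : ℝ))

/-- `ℤ³`-periodicity. -/
def IsLatticePeriodic {α : Type*} (f : KSpace → α) : Prop :=
  ∀ (g : Fin 3 → ℤ) (k : KSpace), f (k + latticeVec g) = f k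

section OneOperator

variable {𝓗 : Type*} [NormedAddCommGroup 𝓗] [InnerProductSpace ℂ 𝓗] [CompleteSpace 𝓗]

/-- The eigenspace of a (possibly unbounded) operator `A` at the real number `E`. -/
def eigSpace (A : 𝓗 →ₗ.[ℂ] 𝓗) (E : ℝ) : Submodule ℂ 𝓗 :=
  (LinearMap.ker (A.toFun - (E : ℂ) • A.domain.subtype)).map A.domain.subtype

/-- The span of all eigenvectors of `A` whose eigenvalue is at most `E`. -/
def lowSpace (A : 𝓗 →ₗ.[ℂ] 𝓗) (E : EReal) : Submodule ℂ 𝓗 :=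
  ⨆ e : {e : ℝ // (e : EReal) ≤ E}, eigSpace A e

/-- The `n`-th eigenvalue of `A` (`n = 1, 2, …`), in increasing order and counted with
multiplicity: the least `E` such that at least `n` eigenvalues are at most `E`.
By convention it is `-∞` for `n = 0`, and `+∞` if `A` has fewer than `n` eigenvalues. -/
def eigVal (A : 𝓗 →ₗ.[ℂ] 𝓗) (n : ℕ) : EReal :=
  sInf {E : EReal | (n : Cardinal) ≤ Module.rank ℂ (lowSpace A E)}

/-- The orthogonal projection onto the span of the eigenvectors of the `n` lowest eigenvalues
(meaningful when the `n`-th eigenvalue is strictly below the next one; the span is then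
finite-dimensional, and so equal to its closure). -/
def lowProj (A : 𝓗 →ₗ.[ℂ] 𝓗) (n : ℕ) : 𝓗 →L[ℂ] 𝓗 :=
  (lowSpace A (eigVal A n)).topologicalClosure.starProjection

/-- `R` is the bounded everywhere defined inverse of `A - z`. -/
def IsResolventAt (A : 𝓗 →ₗ.[ℂ] 𝓗) (z : ℂ) (R : 𝓗 →L[ℂ] 𝓗) : Prop :=
  (∀ x : 𝓗, ∃ h : R x ∈ A.domain, A ⟨R x, h⟩ - z • R x = x) ∧
    ∀ x : A.domain, R (A x - z • (x : 𝓗)) = x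

/-- `A` has an orthonormal basis of eigenvectors whose eigenvalues are listed in increasing
order by the natural numbers. -/
def HasOrderedEigenbasis (A : 𝓗 →ₗ.[ℂ] 𝓗) : Prop :=
  ∃ (b : HilbertBasis ℕ ℂ 𝓗) (e : ℕ → ℝ), Monotone e ∧ ∀ n, b n ∈ eigSpace A (e n)

end OneOperator

section Family

variable {𝓗 : Type*} [NormedAddCommGroup 𝓗] [InnerProductSpace ℂ 𝓗] [CompleteSpace 𝓗]

/-- A real-analytic, `ℤ³`-periodic family of self-adjoint operators on `𝓗`, uniformly bounded
below by `lam`, for which `k ↦ (H k - lam)⁻¹` is analytic, and with eigenvalues that can be listed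
in increasing order. The last requirement is automatic when `dim 𝓗 < ∞`; when `dim 𝓗 = ∞`, it holds
when the resolvent is compact (the case of unbounded operators), but bounded operators with
an increasing sequence of eigenvalues are allowed too. For families of bounded operators (and in
particular when `dim 𝓗 < ∞`), analyticity of the resolvent is the same as analyticity of `H`. -/
def IsAnalyticBlochFamily (H : KSpace → (𝓗 →ₗ.[ℂ] 𝓗)) : Prop :=
  IsLatticePeriodic H ∧ (∀ k, IsSelfAdjoint (H k)) ∧
    ∃ (lam : ℝ) (R : KSpace → (𝓗 →L[ℂ] 𝓗)),
      (∀ k, ∀ x : (H k).domain, lam * ‖(x : 𝓗)‖ ^ 2 ≤ (inner ℂ (x : 𝓗) (H k x)).re) ∧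
      (∀ k, IsResolventAt (H k) (lam : ℂ) (R k)) ∧
      AnalyticOnNhd ℝ R Set.univ ∧
      ∀ k, IsCompactOperator (R k) ∨ HasOrderedEigenbasis (H k)

/-- The crossing set `K_n` of the bands `n` and `n + 1`. -/
def crossingSet (H : KSpace → (𝓗 →ₗ.[ℂ] 𝓗)) (n : ℕ) : Set KSpace :=
  {k | eigVal (H k) n = eigVal (H k) (n + 1)}

/-- `k₀` is a Weyl point of `K_n`: a conical crossing of exactly two eigenvalues, the `n`-th and the
`(n+1)`-st. They coincide at `k₀`, are separated there from the other eigenvalues, and their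
distance grows at least linearly away from `k₀`. -/
def IsWeylPoint (H : KSpace → (𝓗 →ₗ.[ℂ] 𝓗)) (n : ℕ) (k₀ : KSpace) : Prop :=
  1 ≤ n ∧ k₀ ∈ crossingSet H n ∧
    eigVal (H k₀) (n - 1) < eigVal (H k₀) n ∧
    eigVal (H k₀) (n + 1) < eigVal (H k₀) (n + 2) ∧
    ∃ c : ℝ, 0 < c ∧ ∀ᶠ k in 𝓝 k₀,
      eigVal (H k) n + ((c * ‖k - k₀‖ : ℝ) : EReal) ≤ eigVal (H k) (n + 1)

/-- On `U`, `P` is a real-analytic family of orthogonal projections of rank `r`. -/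
def IsAnalyticProjectorOn (P : KSpace → (𝓗 →L[ℂ] 𝓗)) (r : ℕ) (U : Set KSpace) : Prop :=
  AnalyticOnNhd ℝ P U ∧
    ∀ k ∈ U, IsStarProjection (P k) ∧ Module.finrank ℂ (P k).range = r

/-- A crossing of the bands `n` and `n + 1` through which the projector `P_n`, defined outside
`K_n`, has no analytic extension. -/
def IsSingularCrossing (H : KSpace → (𝓗 →ₗ.[ℂ] 𝓗)) (n : ℕ) (k₁ : KSpace) : Prop :=
  k₁ ∈ crossingSet H n ∧
    ¬ ∃ Q : KSpace → (𝓗 →L[ℂ] 𝓗), AnalyticAt ℝ Q k₁ ∧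
      ∀ᶠ k in 𝓝 k₁, k ∉ crossingSet H n → Q k = lowProj (H k) n

/-- The exponentially localised sequences indexed by the lattice. -/
def IsExpLocalised (w : (Fin 3 → ℤ) → 𝓗) : Prop :=
  ∃ C a : ℝ, 0 < a ∧ ∀ g, ‖w g‖ ≤ C * Real.exp (-a * ‖latticeVec g‖)

/-- The Bloch transform at `k` of the function whose restriction to the cell `g` is `w g`. -/
def blochTransform (w : (Fin 3 → ℤ) → 𝓗) (k : KSpace) : 𝓗 :=
  ∑' g : Fin 3 → ℤ, Complex.exp (2 * Real.pi * Complex.I * ((∑ i, (g i : ℝ) * k i : ℝ) : ℂ)) • w g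

end Family

/-- A subset of the torus `ℝ³ / ℤ³`, given as a periodic subset of `ℝ³`, that is a finite union of
points and of piecewise smooth curves (equivalently, of points and smooth arcs, since each piecewise
smooth curve is a finite union of smooth arcs, and arcs of the torus lift to `ℝ³`). -/
def IsFinitePointsAndCurves (K : Set KSpace) : Prop :=
  ∃ (F : Finset KSpace) (m : ℕ) (γ : Fin m → ℝ → KSpace),
    (∀ i, ContDiffOn ℝ (⊤ : ℕ∞) (γ i) (Set.Icc 0 1)) ∧
    K = ⋃ g : Fin 3 → ℤ,
      (fun k => k + latticeVec g) '' ((F : Set KSpace) ∪ ⋃ i, γ i '' Set.Icc 0 1)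

end

/-!
Everything is expressed through the resolvent `R k = (H k - lam)⁻¹`, a bounded positive operator
with the same eigenvectors as `H k`. The only spectral input is that the eigenvectors are total
(`hasPurePointResolvent`); this follows from the spectral theorem when `R k` is compact, and from
the eigenbasis otherwise.

*Analyticity.* If the energy `E` lies in a gap of `H k₁`, then `A = R - (E - lam)⁻¹` is invertible
near `k₁`, and the spectral projection below `E` is `(1 + A / |A|) / 2`. Here `|A|` is the square
root of `A²`, which is analytic by the inverse function theorem applied to squaring
(`exists_analytic_sqrt`). The rank of a continuous family of projections is locally constant, so the
gap persists (`analyticAt_lowProj`).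

*Weyl points.* Let the bands `n` and `n + 1` cross conically at `k₁`, and let `Φ` be an analytic
vector field with `Φ k` in the eigenspace of `ε_{n+1}` for `k ≠ k₁`. Then `Φ = 0`
(`IsWeylPoint.eqOn_zero`). On a line `k₁ + t x` where `Φ` does not vanish identically, dividing by a
power of `t` makes `Φ 0 ≠ 0`. Divided by `t`, the operator `(1 - (ε - lam) R) (P_{n+1} - P_{n-1})`,
with `ε` the crossing energy, is continuous at `t = 0` and has two eigenvalues `τ₁`, `τ₂`, which
belong to the two bands; the cone condition says that `τ₂ - τ₁` jumps from below `-c` to above `c`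
at `t = 0`. But `τ₂` has a limit, since its eigenvector has a non-zero limit, and then `τ₁` has a
limit or merges with `τ₂` (`false_of_eigenvalues_jump`).

*Consequences.* If `P` is analytic of rank `n + 1` and contains `P_n` near a Weyl point, then
`Φ = P_{n+1} (1 - P) u` is such a field for each `u`; hence `P_{n+1} = P_{n+1} P`, and `P = P_{n+1}`
by equality of ranks. The identity theorem spreads the equality over connected sets, among them the
complement of finitely many curves of the torus: for almost every `c`, the segments from `c` to two
given points avoid the curves (`isPreconnected_compl_iUnion_arcs`). If `Q` were an analytic
extension of `P_n` across a Weyl point of `K_n`, then `Φ = (P_{n+1} - Q) u` would be such a field,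
and `P_{n+1} = P_n`. Exponentially localised functions have analytic Bloch transforms
(`analyticAt_blochTransform`), so that orthonormal ones give an analytic projector.
-/

set_option linter.unusedSectionVars false

/-! ### A single operator with a total set of eigenvectors -/

section Single

variable {𝓗 : Type*} [NormedAddCommGroup 𝓗] [InnerProductSpace ℂ 𝓗] [CompleteSpace 𝓗]

/-- `A` is encoded by a bounded positive operator `R = (A - lam)⁻¹`: the eigenvectors of `A` are
the vectors `v` with `(E - lam) • R v = v`, and they span a dense subspace. Nothing is required
about the order in which the eigenvalues can be listed. -/
structure HasPurePointResolvent (A : 𝓗 →ₗ.[ℂ] 𝓗) (lam : ℝ) (R : 𝓗 →L[ℂ] 𝓗) : Prop where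
  symm : ∀ x y, inner ℂ (R x) y = inner ℂ x (R y)
  nonneg : ∀ x, 0 ≤ (inner ℂ x (R x)).re
  mem_eigSpace : ∀ (E : ℝ) (v : 𝓗), v ∈ eigSpace A E ↔ ((E - lam : ℝ) : ℂ) • R v = v
  total : (⨆ E, eigSpace A E).topologicalClosure = ⊤

theorem mem_eigSpace_iff (A : 𝓗 →ₗ.[ℂ] 𝓗) (E : ℝ) (v : 𝓗) :
    v ∈ eigSpace A E ↔ ∃ h : v ∈ A.domain, A ⟨v, h⟩ = (E : ℂ) • v := by
  simp only [eigSpace, Submodule.mem_map, LinearMap.mem_ker]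
  constructor
  · rintro ⟨⟨w, hw⟩, h, rfl⟩
    refine ⟨hw, ?_⟩
    rw [LinearMap.sub_apply, sub_eq_zero] at h
    exact h
  · rintro ⟨h, hv⟩
    refine ⟨⟨v, h⟩, ?_, rfl⟩
    rw [LinearMap.sub_apply, sub_eq_zero]
    exact hv

theorem hasPurePointResolvent (A : 𝓗 →ₗ.[ℂ] 𝓗) (hA : IsSelfAdjoint A) (lam : ℝ) (R : 𝓗 →L[ℂ] 𝓗)
    (hlow : ∀ x : A.domain, lam * ‖(x : 𝓗)‖ ^ 2 ≤ (inner ℂ (x : 𝓗) (A x)).re)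
    (hR : IsResolventAt A (lam : ℂ) R)
    (hb : IsCompactOperator R ∨ HasOrderedEigenbasis A) : HasPurePointResolvent A lam R := by
  have hsymA : ∀ x y : A.domain, inner ℂ (A x) (y : 𝓗) = inner ℂ (x : 𝓗) (A y) := by
    have h := LinearPMap.adjoint_isFormalAdjoint (T := A) hA.dense_domain
    rw [show A.adjoint = A from hA] at h
    exact h
  have hsym : ∀ x y, inner ℂ (R x) y = inner ℂ x (R y) := by
    intro x y
    obtain ⟨hx, hx'⟩ := hR.1 x
    obtain ⟨hy, hy'⟩ := hR.1 y
    have h := hsymA ⟨R x, hx⟩ ⟨R y, hy⟩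
    nth_rewrite 1 [← hy']
    nth_rewrite 2 [← hx']
    simp only [inner_sub_left, inner_sub_right, inner_smul_left, inner_smul_right]
    simp only at h
    rw [h]
    simp
  have hmem : ∀ (E : ℝ) (v : 𝓗), v ∈ eigSpace A E ↔ ((E - lam : ℝ) : ℂ) • R v = v := by
    intro E v
    rw [mem_eigSpace_iff]
    constructor
    · rintro ⟨h, hv⟩
      have := hR.2 ⟨v, h⟩
      simp only at this
      rw [hv, ← sub_smul, map_smul] at this
      simpa using this
    · intro h
      obtain ⟨hx, hx'⟩ := hR.1 v
      have hv : v ∈ A.domain := by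
        rw [← h]; exact A.domain.smul_mem _ hx
      refine ⟨hv, ?_⟩
      have e : (⟨v, hv⟩ : A.domain) = ((E - lam : ℝ) : ℂ) • ⟨R v, hx⟩ := by
        ext; exact h.symm
      have h1 : A ⟨R v, hx⟩ = v + (lam : ℂ) • R v := by
        rw [sub_eq_iff_eq_add] at hx'; exact hx'
      rw [e, LinearPMap.map_smul, h1, smul_add, smul_comm, h, ← add_smul]
      push_cast
      congr 1
      ring
  refine ⟨hsym, ?_, hmem, ?_⟩
  · intro x
    obtain ⟨hx, hx'⟩ := hR.1 x
    have h := hlow ⟨R x, hx⟩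
    rw [← hsym]
    nth_rewrite 2 [← hx']
    rw [inner_sub_right, inner_smul_right, inner_self_eq_norm_sq_to_K]
    simp only [Complex.sub_re]
    have : ((lam : ℂ) * ((‖R x‖ : ℝ) : ℂ) ^ 2).re = lam * ‖R x‖ ^ 2 := by
      norm_cast
    simp only [Complex.coe_algebraMap] at *
    rw [this]
    linarith
  · rcases hb with hc | ⟨b, e, -, hbe⟩
    · have h0 := ContinuousLinearMap.orthogonalComplement_iSup_eigenspaces_eq_bot hc
        (fun x y => hsym x y)
      rw [Submodule.topologicalClosure_eq_top_iff, eq_bot_iff, ← h0]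
      apply Submodule.orthogonal_le
      apply iSup_le
      intro μ v hv
      rw [Module.End.mem_eigenspace_iff] at hv
      change R v = μ • v at hv
      rcases eq_or_ne v 0 with rfl | hv0
      · exact zero_mem _
      have hμ0 : μ ≠ 0 := by
        rintro rfl
        apply hv0
        obtain ⟨hx, hx'⟩ := hR.1 v
        rw [zero_smul] at hv
        have e : (⟨R v, hx⟩ : A.domain) = 0 := by ext; exact hv
        rw [e, hv] at hx'
        simpa using hx'.symm
      have hreal : (μ.re : ℂ) = μ := by
        have h := hsym v v
        rw [hv, inner_smul_left, inner_smul_right] at h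
        have := mul_right_cancel₀ (inner_self_ne_zero.mpr hv0) h
        exact Complex.conj_eq_iff_re.mp this
      apply Submodule.mem_iSup_of_mem (lam + 1 / μ.re)
      rw [hmem, hv, smul_smul]
      have : ((lam + 1 / μ.re - lam : ℝ) : ℂ) * μ = 1 := by
        rw [add_sub_cancel_left]
        push_cast
        rw [hreal]
        field_simp
      rw [this, one_smul]
    · rw [eq_top_iff, ← b.dense_span]
      apply Submodule.topologicalClosure_mono
      rw [Submodule.span_le]
      rintro _ ⟨n, rfl⟩
      exact Submodule.mem_iSup_of_mem _ (hbe n)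

namespace HasPurePointResolvent

variable {A : 𝓗 →ₗ.[ℂ] 𝓗} {lam : ℝ} {R : 𝓗 →L[ℂ] 𝓗}

theorem apply_eq (h : HasPurePointResolvent A lam R) {E : ℝ} (hE : E ≠ lam) {v : 𝓗}
    (hv : v ∈ eigSpace A E) : R v = ((1 / (E - lam) : ℝ) : ℂ) • v := by
  have := (h.mem_eigSpace E v).1 hv
  have h0 : ((E - lam : ℝ) : ℂ) ≠ 0 := by exact_mod_cast sub_ne_zero.2 hE
  calc R v = ((1 / (E - lam) : ℝ) : ℂ) • ((E - lam : ℝ) : ℂ) • R v := by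
        rw [smul_smul]; push_cast at h0 ⊢; rw [one_div, inv_mul_cancel₀ h0, one_smul]
    _ = _ := by rw [this]

theorem lam_lt (h : HasPurePointResolvent A lam R) {E : ℝ} {v : 𝓗}
    (hv : v ∈ eigSpace A E) (hv0 : v ≠ 0) : lam < E := by
  have h1 := (h.mem_eigSpace E v).1 hv
  have h2 := h.nonneg v
  have h3 : (E - lam) * (inner ℂ v (R v)).re = ‖v‖ ^ 2 := by
    have : inner ℂ v (((E - lam : ℝ) : ℂ) • R v) = inner ℂ v v := by rw [h1]
    rw [inner_smul_right, inner_self_eq_norm_sq_to_K] at this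
    have h4 := congrArg Complex.re this
    rw [Complex.re_ofReal_mul] at h4
    rw [h4]
    norm_cast
  have h4 : 0 < ‖v‖ ^ 2 := by positivity
  by_contra hc
  push Not at hc
  nlinarith

theorem inner_eq_zero (h : HasPurePointResolvent A lam R) {E F : ℝ} (hEF : E ≠ F) {v w : 𝓗}
    (hv : v ∈ eigSpace A E) (hw : w ∈ eigSpace A F) : inner ℂ v w = 0 := by
  rcases eq_or_ne v 0 with rfl | hv0
  · simp
  rcases eq_or_ne w 0 with rfl | hw0
  · simp
  have hE := h.lam_lt hv hv0
  have hF := h.lam_lt hw hw0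
  have h1 := h.symm v w
  rw [h.apply_eq hE.ne' hv, h.apply_eq hF.ne' hw, inner_smul_left, inner_smul_right,
    Complex.conj_ofReal, ← sub_eq_zero, ← sub_mul, mul_eq_zero] at h1
  refine h1.resolve_left fun h2 => hEF ?_
  rw [sub_eq_zero] at h2
  have h3 : (1 / (E - lam) : ℝ) = 1 / (F - lam) := by exact_mod_cast h2
  rw [one_div, one_div, inv_inj] at h3
  linarith

theorem orthogonalFamily (h : HasPurePointResolvent A lam R) :
    OrthogonalFamily ℂ (fun E => eigSpace A E) fun E => (eigSpace A E).subtypeₗᵢ :=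
  fun _ _ hEF v w => h.inner_eq_zero hEF v.2 w.2

/-- Bounded operators that agree on all eigenvectors are equal. -/
theorem ext_of_eigSpace (h : HasPurePointResolvent A lam R) {B C : 𝓗 →L[ℂ] 𝓗}
    (hBC : ∀ E, ∀ v ∈ eigSpace A E, B v = C v) : B = C := by
  have h1 : (⨆ E, eigSpace A E) ≤ LinearMap.ker (B - C).toLinearMap := by
    apply iSup_le
    intro E v hv
    rw [LinearMap.mem_ker]
    change (B - C) v = 0
    rw [sub_apply, hBC E v hv, sub_self]
  have h2 := Submodule.topologicalClosure_minimal _ h1 (B - C).isClosed_ker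
  rw [h.total] at h2
  ext v
  have h3 : (B - C) v = 0 := LinearMap.mem_ker.1 (h2 (Submodule.mem_top : v ∈ ⊤))
  rwa [sub_apply, sub_eq_zero] at h3

/-- An operator that is diagonal in the eigenvectors of `A`, with entries bounded by `β`, has norm
at most `β`. -/
theorem norm_le_of_diagonal (h : HasPurePointResolvent A lam R) {B : 𝓗 →L[ℂ] 𝓗} {β : ℝ}
    (hβ : 0 ≤ β) (hB : ∀ E, ∀ v ∈ eigSpace A E, v ≠ 0 → ∃ b : ℝ, |b| ≤ β ∧ B v = (b : ℂ) • v) :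
    ‖B‖ ≤ β := by
  apply ContinuousLinearMap.opNorm_le_bound _ hβ
  have hB' : ∀ E, ∃ b : ℝ, |b| ≤ β ∧ ∀ v ∈ eigSpace A E, B v = (b : ℂ) • v := by
    intro E
    by_cases hE : ∃ w ∈ eigSpace A E, w ≠ 0
    · obtain ⟨w, hw, hw0⟩ := hE
      have hE' := h.lam_lt hw hw0
      obtain ⟨b, hb, hbw⟩ := hB E w hw hw0
      -- the entry may be taken to depend on `E` only: compare `v` with `w` and `v + w`
      refine ⟨b, hb, fun v hv => ?_⟩
      by_cases hlin : ∃ z : ℂ, v = z • w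
      · obtain ⟨z, rfl⟩ := hlin
        rw [map_smul, hbw, smul_comm]
      · push Not at hlin
        have hv0 : v ≠ 0 := by
          rintro rfl; exact hlin 0 (by simp)
        have hvw0 : v + w ≠ 0 := by
          intro h0; exact hlin (-1) (by rw [neg_one_smul]; exact eq_neg_of_add_eq_zero_left h0)
        obtain ⟨b1, -, h1⟩ := hB E v hv hv0
        obtain ⟨b2, -, h2⟩ := hB E (v + w) (add_mem hv hw) hvw0
        rw [map_add, h1, hbw, smul_add] at h2
        have h3 : ((b1 : ℂ) - b2) • v = ((b2 : ℂ) - b) • w := by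
          rw [sub_smul, sub_smul, sub_eq_sub_iff_add_eq_add, h2, add_comm]
        have h4 : (b1 : ℂ) - b2 = 0 := by
          by_contra hne
          apply hlin (((b1 : ℂ) - b2)⁻¹ * ((b2 : ℂ) - b))
          rw [mul_smul, ← h3, smul_smul, inv_mul_cancel₀ hne, one_smul]
        rw [h4, zero_smul, eq_comm, smul_eq_zero] at h3
        have h5 := h3.resolve_right hw0
        rw [h1]
        congr 1
        linear_combination h4 + h5
    · push Not at hE
      refine ⟨0, by simpa using hβ, fun v hv => ?_⟩
      rw [hE v hv]; simp
  choose b hb hbv using hB'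
  have key : ∀ v ∈ (⨆ E, eigSpace A E), ‖B v‖ ≤ β * ‖v‖ := by
    intro v hv
    obtain ⟨f, hf, rfl⟩ := (Submodule.mem_iSup_iff_exists_finsupp _ _).1 hv
    rw [Finsupp.sum]
    apply le_of_sq_le_sq _ (by positivity)
    rw [map_sum, mul_pow]
    have e1 := h.orthogonalFamily.norm_sum (fun E => ⟨f E, hf E⟩) f.support
    have e2 := h.orthogonalFamily.norm_sum
      (fun E => ⟨B (f E), by rw [hbv E _ (hf E)]; exact Submodule.smul_mem _ _ (hf E)⟩) f.support
    simp only [Submodule.coe_subtypeₗᵢ, Submodule.subtype_apply, Submodule.coe_norm] at e1 e2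
    rw [e1, e2, Finset.mul_sum]
    apply Finset.sum_le_sum
    intro E _
    rw [hbv E _ (hf E), norm_smul, mul_pow, Complex.norm_real, Real.norm_eq_abs]
    gcongr
    exact hb E
  intro v
  have hv : v ∈ (⨆ E, eigSpace A E).topologicalClosure := by rw [h.total]; trivial
  have hcl : IsClosed {v : 𝓗 | ‖B v‖ ≤ β * ‖v‖} :=
    isClosed_le (by fun_prop) (by fun_prop)
  exact closure_minimal key hcl hv

end HasPurePointResolvent

theorem lowSpace_mono (A : 𝓗 →ₗ.[ℂ] 𝓗) : Monotone (lowSpace A) := by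
  intro E F hEF
  apply iSup_le
  intro e
  exact le_iSup (fun e : {e : ℝ // (e : EReal) ≤ F} => eigSpace A e) ⟨e.1, e.2.trans hEF⟩

theorem eigSpace_le_lowSpace (A : 𝓗 →ₗ.[ℂ] 𝓗) {e : ℝ} {E : EReal} (h : (e : EReal) ≤ E) :
    eigSpace A e ≤ lowSpace A E :=
  le_iSup (fun e : {e : ℝ // (e : EReal) ≤ E} => eigSpace A e) ⟨e, h⟩

theorem eigVal_mono (A : 𝓗 →ₗ.[ℂ] 𝓗) : Monotone (eigVal A) := by
  intro m n hmn
  apply sInf_le_sInf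
  intro E hE
  rw [Set.mem_ofPred_eq] at hE ⊢
  exact (Nat.cast_le.2 hmn).trans hE

theorem le_rank_lowSpace (A : 𝓗 →ₗ.[ℂ] 𝓗) {n : ℕ} {E : EReal} (h : eigVal A n < E) :
    (n : Cardinal) ≤ Module.rank ℂ (lowSpace A E) := by
  obtain ⟨F, hF, hFE⟩ := sInf_lt_iff.1 h
  exact le_trans hF (Submodule.rank_mono (lowSpace_mono A hFE.le))

theorem rank_lowSpace_lt (A : 𝓗 →ₗ.[ℂ] 𝓗) {n : ℕ} {E : EReal} (h : E < eigVal A n) :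
    Module.rank ℂ (lowSpace A E) < n := by
  by_contra hc
  push Not at hc
  have hmem : E ∈ {E : EReal | (n : Cardinal) ≤ Module.rank ℂ (lowSpace A E)} := hc
  exact absurd (sInf_le hmem) (not_le.2 h)

theorem rank_lowSpace_eq (A : 𝓗 →ₗ.[ℂ] 𝓗) {n : ℕ} {E : EReal} (h : eigVal A n < E)
    (h' : E < eigVal A (n + 1)) : Module.rank ℂ (lowSpace A E) = n := by
  apply le_antisymm _ (le_rank_lowSpace A h)
  have := rank_lowSpace_lt A h'
  obtain ⟨m, hm⟩ := Cardinal.lt_aleph0.1 (this.trans Cardinal.natCast_lt_aleph0)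
  rw [hm, Nat.cast_lt] at this
  rw [hm, Nat.cast_le]
  omega

theorem finiteDimensional_of_rank_eq {S : Submodule ℂ 𝓗} {n : ℕ}
    (h : Module.rank ℂ S = n) : FiniteDimensional ℂ S :=
  Module.rank_lt_aleph0_iff.1 (h ▸ Cardinal.natCast_lt_aleph0)

theorem eigVal_le_of_rank_eq (A : 𝓗 →ₗ.[ℂ] 𝓗) {n : ℕ} {E : EReal}
    (h : Module.rank ℂ (lowSpace A E) = n) : eigVal A n ≤ E := by
  have hmem : E ∈ {E : EReal | (n : Cardinal) ≤ Module.rank ℂ (lowSpace A E)} := h.ge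
  exact sInf_le hmem

theorem le_eigVal_of_rank_eq (A : 𝓗 →ₗ.[ℂ] 𝓗) {n : ℕ} {E : EReal}
    (h : Module.rank ℂ (lowSpace A E) = n) : E ≤ eigVal A (n + 1) := by
  by_contra hc
  push Not at hc
  have := le_rank_lowSpace A hc
  rw [h] at this
  have := Nat.cast_le.1 this
  omega

theorem isStarProjection_lowProj (A : 𝓗 →ₗ.[ℂ] 𝓗) (n : ℕ) : IsStarProjection (lowProj A n) :=
  isStarProjection_starProjection

theorem range_lowProj_mono (A : 𝓗 →ₗ.[ℂ] 𝓗) {m n : ℕ} (hmn : m ≤ n) :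
    (lowProj A m).range ≤ (lowProj A n).range := by
  rw [lowProj, lowProj, Submodule.range_starProjection, Submodule.range_starProjection]
  exact Submodule.topologicalClosure_mono (lowSpace_mono A (eigVal_mono A hmn))

namespace HasPurePointResolvent

variable {A : 𝓗 →ₗ.[ℂ] 𝓗} {lam : ℝ} {R : 𝓗 →L[ℂ] 𝓗}

theorem inner_lowSpace_eq_zero (h : HasPurePointResolvent A lam R) {e : ℝ} {E : EReal}
    (hE : E < e) {v w : 𝓗} (hv : v ∈ eigSpace A e) (hw : w ∈ lowSpace A E) : inner ℂ v w = 0 := by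
  have : lowSpace A E ≤ (ℂ ∙ v)ᗮ := by
    apply iSup_le
    rintro ⟨f, hf⟩ w hw
    rw [Submodule.mem_orthogonal_singleton_iff_inner_right]
    refine h.inner_eq_zero ?_ hv hw
    rintro rfl
    exact absurd hf (not_le.2 hE)
  exact Submodule.mem_orthogonal_singleton_iff_inner_right.1 (this hw)

/-- Between `ε_n` and `ε_{n+1}` there is no eigenvalue. -/
theorem le_or_le_of_gap (h : HasPurePointResolvent A lam R) {n : ℕ} {e : ℝ} {v : 𝓗}
    (hv : v ∈ eigSpace A e) (hv0 : v ≠ 0) : e ≤ eigVal A n ∨ eigVal A (n + 1) ≤ e := by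
  by_contra! hc
  obtain ⟨E1, h1, h1'⟩ := exists_between hc.1
  have r1 := rank_lowSpace_eq A h1 (h1'.trans hc.2)
  have r2 := rank_lowSpace_eq A hc.1 hc.2
  have := finiteDimensional_of_rank_eq r2
  have heq : lowSpace A E1 = lowSpace A e := by
    apply Submodule.eq_of_le_of_finrank_eq (lowSpace_mono A h1'.le)
    rw [Module.finrank, Module.finrank, r1, r2]
  have h3 := eigSpace_le_lowSpace A (le_refl (e : EReal)) hv
  rw [← heq] at h3
  exact hv0 (inner_self_eq_zero.1 (h.inner_lowSpace_eq_zero h1' hv h3))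

/-- The defining subspace of `lowProj` may be cut at any energy in the gap. -/
theorem lowSpace_eigVal_eq (h : HasPurePointResolvent A lam R) {n : ℕ} {E : EReal}
    (h1 : eigVal A n < E) (h2 : E < eigVal A (n + 1)) :
    lowSpace A (eigVal A n) = lowSpace A E := by
  apply le_antisymm (lowSpace_mono A h1.le)
  apply iSup_le
  rintro ⟨e, he⟩ v hv
  rcases eq_or_ne v 0 with rfl | hv0
  · exact zero_mem _
  refine eigSpace_le_lowSpace A ?_ hv
  refine (h.le_or_le_of_gap (n := n) hv hv0).resolve_right fun h3 => ?_
  exact absurd (he.trans_lt h2) (not_lt.2 h3)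

theorem rank_lowSpace_eigVal (h : HasPurePointResolvent A lam R) {n : ℕ}
    (hgap : eigVal A n < eigVal A (n + 1)) : Module.rank ℂ (lowSpace A (eigVal A n)) = n := by
  obtain ⟨E, h1, h2⟩ := exists_between hgap
  rw [h.lowSpace_eigVal_eq h1 h2, rank_lowSpace_eq A h1 h2]

theorem starProjection_apply_of_le {e : ℝ} {E : EReal} {v : 𝓗} (hv : v ∈ eigSpace A e)
    (he : (e : EReal) ≤ E) : (lowSpace A E).topologicalClosure.starProjection v = v :=
  Submodule.starProjection_eq_self_iff.2
    (Submodule.le_topologicalClosure _ (eigSpace_le_lowSpace A he hv))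

theorem starProjection_apply_of_lt (h : HasPurePointResolvent A lam R) {e : ℝ} {E : EReal} {v : 𝓗}
    (hv : v ∈ eigSpace A e) (he : E < e) :
    (lowSpace A E).topologicalClosure.starProjection v = 0 := by
  rw [Submodule.starProjection_apply_eq_zero_iff, Submodule.orthogonal_closure,
    Submodule.mem_orthogonal']
  exact fun w hw => h.inner_lowSpace_eq_zero he hv hw

theorem lowProj_apply_of_le {e : ℝ} {n : ℕ} {v : 𝓗} (hv : v ∈ eigSpace A e)
    (he : (e : EReal) ≤ eigVal A n) : lowProj A n v = v := starProjection_apply_of_le hv he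

theorem lowProj_apply_of_lt (h : HasPurePointResolvent A lam R) {e : ℝ} {n : ℕ} {v : 𝓗}
    (hv : v ∈ eigSpace A e) (he : eigVal A n < e) : lowProj A n v = 0 :=
  h.starProjection_apply_of_lt hv he

theorem rank_range_lowProj (h : HasPurePointResolvent A lam R) {n : ℕ}
    (hgap : eigVal A n < eigVal A (n + 1)) : Module.rank ℂ (lowProj A n).range = n := by
  have h1 := h.rank_lowSpace_eigVal hgap
  have := finiteDimensional_of_rank_eq h1
  rw [lowProj, Submodule.range_starProjection,
    (Submodule.closed_of_finiteDimensional _).submodule_topologicalClosure_eq, h1]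

theorem lam_lt_eigVal (h : HasPurePointResolvent A lam R) (n : ℕ) :
    (lam : EReal) < eigVal A (n + 1) := by
  -- an eigenvalue `e` satisfies `1 ≤ (e - lam) * ‖R‖`, so that none is below `lam + (‖R‖ + 1)⁻¹`
  have hbot : lowSpace A ((lam + 1 / (‖R‖ + 1) : ℝ) : EReal) = ⊥ := by
    rw [eq_bot_iff]
    apply iSup_le
    rintro ⟨e, he⟩ v hv
    rw [Submodule.mem_bot]
    by_contra hv0
    have h1 := h.lam_lt hv hv0
    have h2 : e ≤ lam + 1 / (‖R‖ + 1) := by exact_mod_cast he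
    have h3 := R.le_opNorm v
    rw [h.apply_eq h1.ne' hv, norm_smul, Complex.norm_real, Real.norm_eq_abs,
      abs_of_pos (one_div_pos.2 (sub_pos.2 h1))] at h3
    have h4 := le_of_mul_le_mul_right h3 (norm_pos_iff.2 hv0)
    have h5 : 1 / (1 / (‖R‖ + 1)) ≤ 1 / (e - lam) :=
      one_div_le_one_div_of_le (sub_pos.2 h1) (by linarith)
    rw [one_div_one_div] at h5
    linarith
  have h1 : ((lam + 1 / (‖R‖ + 1) : ℝ) : EReal) ≤ eigVal A (0 + 1) := by
    apply le_eigVal_of_rank_eq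
    rw [hbot]
    simp
  have h2 : (lam : EReal) < ((lam + 1 / (‖R‖ + 1) : ℝ) : EReal) := by
    rw [EReal.coe_lt_coe_iff]
    have : 0 < 1 / (‖R‖ + 1) := by positivity
    linarith
  exact (h2.trans_le h1).trans_le (eigVal_mono A (by omega))

/-- If `ε_m < ε_{m+1} = ε_l < ε_{l+1}`, then `P_l - P_m` maps into the eigenspace of `ε_l`. -/
theorem lowProj_sub_mem_eigSpace (h : HasPurePointResolvent A lam R) {m l : ℕ} {e : ℝ}
    (hm : eigVal A m < eigVal A (m + 1)) (hml : eigVal A (m + 1) = e) (hl : eigVal A l = e)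
    (hl' : eigVal A l < eigVal A (l + 1)) (v : 𝓗) :
    (lowProj A l - lowProj A m) v ∈ eigSpace A e := by
  rw [h.mem_eigSpace]
  have : ((e - lam : ℝ) : ℂ) • R * (lowProj A l - lowProj A m) = lowProj A l - lowProj A m := by
    apply h.ext_of_eigSpace
    intro f w hw
    rcases eq_or_ne w 0 with rfl | hw0
    · simp
    simp only [mul_apply_eq_comp, sub_apply,
      smul_apply]
    rcases h.le_or_le_of_gap (n := m) hw hw0 with h1 | h1
    · rw [lowProj_apply_of_le hw h1, lowProj_apply_of_le hw]
      · simp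
      · exact h1.trans (by rw [hl, ← hml]; exact hm.le)
    · rw [h.lowProj_apply_of_lt hw (hm.trans_le h1)]
      rcases h.le_or_le_of_gap (n := l) hw hw0 with h2 | h2
      · rw [lowProj_apply_of_le hw h2, sub_zero]
        have : f = e := by
          rw [hml] at h1
          rw [hl] at h2
          exact le_antisymm (by exact_mod_cast h2) (by exact_mod_cast h1)
        subst this
        exact (h.mem_eigSpace _ _).1 hw
      · rw [h.lowProj_apply_of_lt hw (hl'.trans_le h2)]
        simp
  exact DFunLike.congr_fun this v

end HasPurePointResolvent

end Single

/-! ### Analyticity of spectral projections -/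

section SquareRoot

variable {B : Type*} [NormedRing B] [NormedAlgebra ℝ B] [CompleteSpace B]

/-- A perturbation of `s` of norm less than `s` is invertible. -/
theorem isUnit_of_norm_smul_one_sub_lt {X : B} {s : ℝ} (hX : ‖s • (1 : B) - X‖ < s) :
    IsUnit X := by
  have hs : 0 < s := (norm_nonneg _).trans_lt hX
  have h1 : ‖1 - s⁻¹ • X‖ < 1 := by
    have e : 1 - s⁻¹ • X = s⁻¹ • (s • (1 : B) - X) := by
      rw [smul_sub, smul_smul, inv_mul_cancel₀ hs.ne', one_smul]
    rw [e, norm_smul, Real.norm_of_nonneg (by positivity), inv_mul_lt_iff₀ hs, mul_one]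
    exact hX
  have h2 := (Units.oneSub _ h1).isUnit
  have h3 : IsUnit (s⁻¹ • X) := by simpa using h2
  have h4 : X = algebraMap ℝ B s * (s⁻¹ • X) := by
    rw [← Algebra.smul_def, smul_smul, mul_inv_cancel₀ hs.ne', one_smul]
  rw [h4]
  exact (hs.ne'.isUnit.map (algebraMap ℝ B)).mul h3

/-- Near an element of the form `s - T` with `‖T‖ < s`, squaring has an analytic local inverse. -/
theorem exists_analytic_sqrt (X₀ : B) {s : ℝ} (hX₀ : ‖s • (1 : B) - X₀‖ < s) :
    ∃ G : B → B, AnalyticAt ℝ G (X₀ * X₀) ∧ G (X₀ * X₀) = X₀ ∧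
      ∀ᶠ y in 𝓝 (X₀ * X₀), G y * G y = y := by
  have hs : 0 < s := (norm_nonneg _).trans_lt hX₀
  set sq : B → B := fun x => x * x with hsq
  have han : AnalyticAt ℝ sq X₀ := analyticAt_id.mul analyticAt_id
  -- the derivative `Y ↦ X₀ Y + Y X₀` of squaring is `2 s` times a perturbation of the identity
  set D : B →L[ℝ] B := ContinuousLinearMap.mul ℝ B X₀ + (ContinuousLinearMap.mul ℝ B).flip X₀
    with hD
  have hderiv : HasStrictFDerivAt sq D X₀ := by
    have := (hasStrictFDerivAt_id (𝕜 := ℝ) X₀).mul' (hasStrictFDerivAt_id (𝕜 := ℝ) X₀)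
    convert! this using 1
  have hDunit : IsUnit D := by
    apply isUnit_of_norm_smul_one_sub_lt (s := 2 * s)
    have e : (2 * s) • (1 : B →L[ℝ] B) - D = ContinuousLinearMap.mul ℝ B (s • (1 : B) - X₀) +
        (ContinuousLinearMap.mul ℝ B).flip (s • (1 : B) - X₀) := by
      ext y
      simp only [hD, sub_apply, one_apply_eq_self, smul_apply,
        add_apply, ContinuousLinearMap.mul_apply', ContinuousLinearMap.flip_apply,
        sub_mul, mul_sub, smul_mul_assoc, mul_smul_comm, one_mul, mul_one]
      rw [two_mul, add_smul]
      abel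
    have h1 := ContinuousLinearMap.opNorm_mul_apply_le ℝ B (s • (1 : B) - X₀)
    have h2 : ‖(ContinuousLinearMap.mul ℝ B).flip (s • (1 : B) - X₀)‖ ≤ ‖s • (1 : B) - X₀‖ := by
      apply ContinuousLinearMap.opNorm_le_bound _ (norm_nonneg _)
      intro y
      rw [ContinuousLinearMap.flip_apply, ContinuousLinearMap.mul_apply', mul_comm ‖_‖]
      exact norm_mul_le _ _
    rw [e]
    calc _ ≤ _ := norm_add_le _ _
      _ < 2 * s := by linarith
  set i : B ≃L[ℝ] B := ContinuousLinearEquiv.unitsEquiv ℝ B hDunit.unit with hi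
  have hiD : (i : B →L[ℝ] B) = D := by
    ext y
    simp [hi]
  have hderiv' : HasStrictFDerivAt sq (i : B →L[ℝ] B) X₀ := hiD ▸ hderiv
  set f := hderiv'.toOpenPartialHomeomorph sq with hf
  have hmem := hderiv'.mem_toOpenPartialHomeomorph_source
  refine ⟨f.symm, ?_, ?_, ?_⟩
  · have := f.analyticAt_symm' (i := i) hmem han (hderiv'.hasFDerivAt.fderiv)
    exact this
  · exact f.left_inv hmem
  · exact f.eventually_right_inverse' hmem

end SquareRoot

section Family

variable {𝓗 : Type*} [NormedAddCommGroup 𝓗] [InnerProductSpace ℂ 𝓗] [CompleteSpace 𝓗]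

/-- If `‖p - q‖ < 1`, then `q` is injective on the range of the projection `p`. -/
theorem rank_range_le_of_norm_sub_lt_one {p q : 𝓗 →L[ℂ] 𝓗} (hp : IsStarProjection p)
    (h : ‖p - q‖ < 1) : Module.rank ℂ p.range ≤ Module.rank ℂ q.range := by
  let f : p.range →ₗ[ℂ] q.range :=
    (q.toLinearMap.codRestrict q.range (fun x => LinearMap.mem_range_self _ x)).comp
      p.range.subtype
  apply LinearMap.rank_le_of_injective f
  rw [← LinearMap.ker_eq_bot, LinearMap.ker_eq_bot']
  rintro ⟨x, ⟨y, rfl⟩⟩ hx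
  have hq : q (p y) = 0 := congrArg Subtype.val hx
  have hpp : p (p y) = p y := DFunLike.congr_fun hp.isIdempotentElem y
  have h1 : (p - q) (p y) = p y := by rw [sub_apply, hpp, hq, sub_zero]
  have h2 := (p - q).le_opNorm (p y)
  rw [h1] at h2
  have h3 : ‖p y‖ = 0 := by
    by_contra h0
    have : 0 < ‖p y‖ := lt_of_le_of_ne (norm_nonneg _) (Ne.symm h0)
    nlinarith
  ext
  simpa using h3

theorem rank_range_eq_of_norm_sub_lt_one {p q : 𝓗 →L[ℂ] 𝓗} (hp : IsStarProjection p)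
    (hq : IsStarProjection q) (h : ‖p - q‖ < 1) :
    Module.rank ℂ p.range = Module.rank ℂ q.range :=
  le_antisymm (rank_range_le_of_norm_sub_lt_one hp h)
    (rank_range_le_of_norm_sub_lt_one hq (by rwa [norm_sub_rev]))

/-- If `X² = A²` where `X = s - T` with `‖T‖ < s`, then `X` acts as `|a|` on an eigenvector of `A`
with eigenvalue `a`: the factor `X + |a|` of `X² - a²` is injective. -/
theorem sqrt_apply_eigenvector {A X : 𝓗 →L[ℂ] 𝓗} {s a : ℝ} (hX : ‖s • (1 : 𝓗 →L[ℂ] 𝓗) - X‖ < s)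
    (hXA : X * X = A * A) {v : 𝓗} (hv : A v = (a : ℂ) • v) : X v = ((|a| : ℝ) : ℂ) • v := by
  set w := X v - ((|a| : ℝ) : ℂ) • v with hw
  have h1 : X w + ((|a| : ℝ) : ℂ) • w = 0 := by
    have h2 : X (X v) = A (A v) := DFunLike.congr_fun hXA v
    rw [hw, map_sub, h2, hv, map_smul, hv, map_smul, smul_sub, smul_smul, smul_smul,
      ← Complex.ofReal_mul, ← Complex.ofReal_mul, abs_mul_abs_self]
    abel
  have h3 : (s • (1 : 𝓗 →L[ℂ] 𝓗) - X) w = ((s + |a| : ℝ) : ℂ) • w := by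
    rw [sub_apply, smul_apply, one_apply_eq_self, eq_neg_of_add_eq_zero_left h1,
      sub_neg_eq_add, Complex.ofReal_add, add_smul]
    congr 1
  have h4 := (s • (1 : 𝓗 →L[ℂ] 𝓗) - X).le_opNorm w
  rw [h3, norm_smul, Complex.norm_real, Real.norm_eq_abs,
    abs_of_nonneg (by have := (norm_nonneg _).trans_lt hX; positivity)] at h4
  have h5 : ‖w‖ = 0 := by
    by_contra h0
    have : 0 < ‖w‖ := lt_of_le_of_ne (norm_nonneg _) (Ne.symm h0)
    have := abs_nonneg a
    nlinarith
  rw [norm_eq_zero, hw, sub_eq_zero] at h5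
  exact h5

/-- The spectral projection as `(1 + A / |A|) / 2` with `A = R - (E - lam)⁻¹`. -/
theorem HasPurePointResolvent.starProjection_eq {A : 𝓗 →ₗ.[ℂ] 𝓗} {lam : ℝ} {R X : 𝓗 →L[ℂ] 𝓗}
    (h : HasPurePointResolvent A lam R) {E s : ℝ} (hE : lam < E)
    (hX : ‖s • (1 : 𝓗 →L[ℂ] 𝓗) - X‖ < s)
    (hXA : X * X = (R - (1 / (E - lam)) • 1) * (R - (1 / (E - lam)) • 1)) :
    (lowSpace A E).topologicalClosure.starProjection =
      (2⁻¹ : ℝ) • (1 + (R - (1 / (E - lam)) • 1) * Ring.inverse X) := by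
  apply h.ext_of_eigSpace
  intro e v hv
  rcases eq_or_ne v 0 with rfl | hv0
  · simp
  have he := h.lam_lt hv hv0
  have hX' := isUnit_of_norm_smul_one_sub_lt hX
  set a : ℝ := 1 / (e - lam) - 1 / (E - lam) with ha
  have hAv : (R - (1 / (E - lam)) • (1 : 𝓗 →L[ℂ] 𝓗)) v = (a : ℂ) • v := by
    rw [sub_apply, h.apply_eq he.ne' hv, smul_apply, one_apply_eq_self, ha, Complex.ofReal_sub,
      sub_smul]
    congr 1
  have hXv := sqrt_apply_eigenvector hX hXA hAv
  have hinv : Ring.inverse X * X = 1 := Ring.inverse_mul_cancel X hX'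
  have hinvX : ∀ w, Ring.inverse X (X w) = w := fun w => DFunLike.congr_fun hinv w
  have ha0 : a ≠ 0 := by
    intro h0
    rw [h0] at hXv
    apply hv0
    rw [← hinvX v, hXv]
    simp
  have habs : ((|a| : ℝ) : ℂ) ≠ 0 := by exact_mod_cast abs_ne_zero.2 ha0
  have hinvv : Ring.inverse X v = ((|a| : ℝ) : ℂ)⁻¹ • v := by
    have := hinvX v
    rw [hXv, map_smul] at this
    nth_rewrite 2 [← this]
    rw [smul_smul, inv_mul_cancel₀ habs, one_smul]
  have hR : ((2⁻¹ : ℝ) • (1 + (R - (1 / (E - lam)) • (1 : 𝓗 →L[ℂ] 𝓗)) * Ring.inverse X)) v =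
      (2⁻¹ : ℝ) • (v + (((|a| : ℝ) : ℂ)⁻¹ * a) • v) := by
    rw [smul_apply, add_apply, one_apply_eq_self, mul_apply_eq_comp, hinvv, map_smul, hAv,
      smul_smul]
  rw [hR]
  rcases le_or_gt e E with heE | heE
  · rw [starProjection_apply_of_le hv (by exact_mod_cast heE)]
    have : 0 < a := by
      refine lt_of_le_of_ne ?_ (Ne.symm ha0)
      rw [ha, sub_nonneg]
      exact one_div_le_one_div_of_le (by linarith) (by linarith)
    rw [abs_of_pos this] at habs ⊢
    rw [inv_mul_cancel₀ habs, one_smul, ← two_smul ℝ v, smul_smul]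
    norm_num
  · rw [h.starProjection_apply_of_lt hv (by exact_mod_cast heE)]
    have : a < 0 := by
      refine lt_of_le_of_ne ?_ ha0
      rw [ha, sub_nonpos]
      exact one_div_le_one_div_of_le (by linarith) (by linarith)
    rw [abs_of_neg this] at habs ⊢
    have e1 : ((-a : ℝ) : ℂ)⁻¹ * a = -1 := by
      field_simp
      push_cast
      ring
    rw [e1]
    simp

/-- A gap of the spectrum at `E` gives a square root of `(R - (E - lam)⁻¹)²` that is a small
perturbation of a positive multiple of the identity. -/
theorem HasPurePointResolvent.exists_sqrt_of_gap {A : 𝓗 →ₗ.[ℂ] 𝓗} {lam : ℝ} {R : 𝓗 →L[ℂ] 𝓗}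
    (h : HasPurePointResolvent A lam R) {n : ℕ} {E : ℝ} (hE : lam < E)
    (h1 : eigVal A n < E) (h2 : E < eigVal A (n + 1)) :
    ∃ (s : ℝ) (X : 𝓗 →L[ℂ] 𝓗), ‖s • (1 : 𝓗 →L[ℂ] 𝓗) - X‖ < s ∧
      X * X = (R - (1 / (E - lam)) • 1) * (R - (1 / (E - lam)) • 1) := by
  obtain ⟨E₁, hE₁, hE₁'⟩ := EReal.exists_rat_btwn_of_lt (max_lt h1 (EReal.coe_lt_coe_iff.2 hE))
  obtain ⟨E₂, hE₂, hE₂'⟩ := EReal.exists_rat_btwn_of_lt h2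
  have hE₁E : ((E₁ : ℝ) : ℝ) < E := by exact_mod_cast hE₁'
  have hlE₁ : lam < (E₁ : ℝ) := by exact_mod_cast (le_max_right _ _).trans_lt hE₁
  have hEE₂ : E < ((E₂ : ℝ) : ℝ) := by exact_mod_cast hE₂
  set p := (lowSpace A E).topologicalClosure.starProjection with hp
  set A₀ := R - (1 / (E - lam)) • (1 : 𝓗 →L[ℂ] 𝓗) with hA₀
  set X : 𝓗 →L[ℂ] 𝓗 := (2 • p - 1) * A₀ with hX
  set δ : ℝ := min (1 / (E₁ - lam) - 1 / (E - lam)) (1 / (E - lam) - 1 / (E₂ - lam)) with hδ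
  have hδ0 : 0 < δ := by
    rw [hδ, lt_min_iff, sub_pos, sub_pos]
    constructor <;> apply one_div_lt_one_div_of_lt <;> linarith
  have key : ∀ e, ∀ v ∈ eigSpace A e, v ≠ 0 → ∃ a : ℝ, δ ≤ |a| ∧ |a| ≤ ‖A₀‖ ∧
      A₀ v = (a : ℂ) • v ∧ X v = ((|a| : ℝ) : ℂ) • v := by
    intro e v hv hv0
    have he := h.lam_lt hv hv0
    set a : ℝ := 1 / (e - lam) - 1 / (E - lam) with ha
    have hAv : A₀ v = (a : ℂ) • v := by
      rw [hA₀, sub_apply, h.apply_eq he.ne' hv, smul_apply, one_apply_eq_self, ha,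
        Complex.ofReal_sub, sub_smul]
      congr 1
    refine ⟨a, ?_, ?_, hAv, ?_⟩
    · rcases h.le_or_le_of_gap (n := n) hv hv0 with h3 | h3
      · refine (min_le_left _ _).trans ((sub_le_sub_right ?_ _).trans (le_abs_self _))
        apply one_div_le_one_div_of_le (by linarith)
        have : (e : EReal) < (E₁ : ℝ) := h3.trans_lt ((le_max_left _ _).trans_lt hE₁)
        have : e < E₁ := by exact_mod_cast this
        linarith
      · refine (min_le_right _ _).trans (le_trans ?_ (neg_le_abs _))
        rw [ha, neg_sub]
        apply sub_le_sub_left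
        apply one_div_le_one_div_of_le (by linarith)
        have : ((E₂ : ℝ) : EReal) < e := hE₂'.trans_le h3
        have : E₂ < e := by exact_mod_cast this
        linarith
    · have := A₀.le_opNorm v
      rw [hAv, norm_smul, Complex.norm_real] at this
      exact le_of_mul_le_mul_right this (norm_pos_iff.2 hv0)
    · rw [hX, mul_apply_eq_comp, hAv, map_smul, sub_apply, smul_apply, one_apply_eq_self]
      rcases h.le_or_le_of_gap (n := n) hv hv0 with h3 | h3
      · have h4 : (e : EReal) < E := h3.trans_lt h1
        rw [hp, starProjection_apply_of_le hv h4.le, two_smul, add_sub_cancel_right, abs_of_nonneg]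
        rw [ha, sub_nonneg]
        have : e < E := by exact_mod_cast h4
        exact one_div_le_one_div_of_le (by linarith) (by linarith)
      · have h4 : (E : EReal) < e := h2.trans_le h3
        rw [hp, h.starProjection_apply_of_lt hv h4, smul_zero, zero_sub, abs_of_nonpos]
        · simp
        · rw [ha, sub_nonpos]
          have : E < e := by exact_mod_cast h4
          exact one_div_le_one_div_of_le (by linarith) (by linarith)
  refine ⟨‖A₀‖ + δ, X, ?_, ?_⟩
  · have : ‖(‖A₀‖ + δ) • (1 : 𝓗 →L[ℂ] 𝓗) - X‖ ≤ ‖A₀‖ := by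
      apply h.norm_le_of_diagonal (norm_nonneg _)
      intro e v hv hv0
      obtain ⟨a, ha, ha', -, hXv⟩ := key e v hv hv0
      refine ⟨‖A₀‖ + δ - |a|, ?_, ?_⟩
      · rw [abs_of_nonneg (by linarith)]; linarith
      · rw [sub_apply, hXv, smul_apply, one_apply_eq_self, Complex.ofReal_sub, sub_smul]
        congr 1
    linarith
  · apply h.ext_of_eigSpace
    intro e v hv
    rcases eq_or_ne v 0 with rfl | hv0
    · simp
    obtain ⟨a, -, -, hAv, hXv⟩ := key e v hv hv0
    change X (X v) = A₀ (A₀ v)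
    rw [hXv, hAv, map_smul, map_smul, hXv, hAv, smul_smul, smul_smul,
      ← Complex.ofReal_mul, ← Complex.ofReal_mul, abs_mul_abs_self]

variable {𝓚 : Type*} [NormedAddCommGroup 𝓚] [NormedSpace ℝ 𝓚]

/-- The spectral projection below an energy `E` in a gap is analytic in the parameter, and its rank
is locally constant. -/
theorem exists_analytic_spectral_projection {H : 𝓚 → (𝓗 →ₗ.[ℂ] 𝓗)} {lam : ℝ}
    {R : 𝓚 → (𝓗 →L[ℂ] 𝓗)} (h : ∀ k, HasPurePointResolvent (H k) lam (R k)) {k₁ : 𝓚}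
    (hR : AnalyticAt ℝ R k₁) {n : ℕ} {E : ℝ} (hE : lam < E)
    (h1 : eigVal (H k₁) n < E) (h2 : E < eigVal (H k₁) (n + 1)) :
    AnalyticAt ℝ (fun k => (lowSpace (H k) E).topologicalClosure.starProjection) k₁ ∧
      ∀ᶠ k in 𝓝 k₁, Module.rank ℂ (lowSpace (H k) E) = n := by
  obtain ⟨s, X₀, hX₀, hXA⟩ := (h k₁).exists_sqrt_of_gap hE h1 h2
  obtain ⟨G, hG, hGX, hGsq⟩ := exists_analytic_sqrt X₀ hX₀
  set A : 𝓚 → (𝓗 →L[ℂ] 𝓗) := fun k => R k - (1 / (E - lam)) • 1 with hA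
  have hAan : AnalyticAt ℝ A k₁ := hR.sub analyticAt_const
  have hA2 : AnalyticAt ℝ (fun k => A k * A k) k₁ := hAan.mul hAan
  rw [hXA] at hG hGX hGsq
  have hXan : AnalyticAt ℝ (fun k => G (A k * A k)) k₁ :=
    AnalyticAt.fun_comp (f := fun k => A k * A k) hG hA2
  have hev : ∀ᶠ k in 𝓝 k₁, (lowSpace (H k) E).topologicalClosure.starProjection =
      (2⁻¹ : ℝ) • (1 + A k * Ring.inverse (G (A k * A k))) := by
    have e1 : ∀ᶠ k in 𝓝 k₁, G (A k * A k) * G (A k * A k) = A k * A k :=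
      hA2.continuousAt.eventually hGsq
    have e2 : ∀ᶠ k in 𝓝 k₁, ‖s • (1 : 𝓗 →L[ℂ] 𝓗) - G (A k * A k)‖ < s := by
      have : ContinuousAt (fun k => ‖s • (1 : 𝓗 →L[ℂ] 𝓗) - G (A k * A k)‖) k₁ :=
        (continuousAt_const.sub hXan.continuousAt).norm
      apply this.eventually_lt continuousAt_const
      simp only [hA]
      rw [hGX]
      exact hX₀
    filter_upwards [e1, e2] with k h1 h2
    exact (h k).starProjection_eq hE h2 h1
  have hunit : IsUnit (G (A k₁ * A k₁)) := by
    simp only [hA]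
    rw [hGX]
    exact isUnit_of_norm_smul_one_sub_lt hX₀
  have hinv : AnalyticAt ℝ (fun k => Ring.inverse (G (A k * A k))) k₁ := by
    obtain ⟨u, hu⟩ := hunit
    have := analyticAt_inverse (𝕜 := ℝ) u
    rw [hu] at this
    exact AnalyticAt.fun_comp (f := fun k => G (A k * A k)) this hXan
  have han : AnalyticAt ℝ (fun k => (lowSpace (H k) E).topologicalClosure.starProjection) k₁ := by
    have : AnalyticAt ℝ (fun k => (2⁻¹ : ℝ) • (1 + A k * Ring.inverse (G (A k * A k)))) k₁ :=
      analyticAt_const.fun_smul (analyticAt_const.fun_add (hAan.fun_mul hinv))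
    exact this.congr (hev.mono fun k hk => hk.symm)
  refine ⟨han, ?_⟩
  have hclose := Metric.continuousAt_iff'.1 han.continuousAt 1 one_pos
  filter_upwards [hclose] with k hk
  rw [dist_eq_norm] at hk
  have hr := rank_range_eq_of_norm_sub_lt_one isStarProjection_starProjection
    isStarProjection_starProjection hk
  have hr₁ := rank_lowSpace_eq (H k₁) h1 h2
  have := finiteDimensional_of_rank_eq hr₁
  rw [Submodule.range_starProjection, Submodule.range_starProjection,
    ((lowSpace (H k₁) E).closed_of_finiteDimensional).submodule_topologicalClosure_eq, hr₁] at hr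
  have hle := Submodule.le_topologicalClosure (lowSpace (H k) E)
  have := finiteDimensional_of_rank_eq hr
  have : FiniteDimensional ℂ (lowSpace (H k) E) := Submodule.finiteDimensional_of_le hle
  rwa [((lowSpace (H k) E).closed_of_finiteDimensional).submodule_topologicalClosure_eq] at hr

/-- A gap between `ε_n` and `ε_{n+1}` is an open condition, and `P_n` is analytic there. -/
theorem analyticAt_lowProj {H : 𝓚 → (𝓗 →ₗ.[ℂ] 𝓗)} {lam : ℝ}
    {R : 𝓚 → (𝓗 →L[ℂ] 𝓗)} (h : ∀ k, HasPurePointResolvent (H k) lam (R k)) {k₁ : 𝓚}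
    (hR : AnalyticAt ℝ R k₁) {n : ℕ} (hgap : eigVal (H k₁) n < eigVal (H k₁) (n + 1)) :
    AnalyticAt ℝ (fun k => lowProj (H k) n) k₁ ∧
      ∀ᶠ k in 𝓝 k₁, eigVal (H k) n < eigVal (H k) (n + 1) := by
  have hlam := (h k₁).lam_lt_eigVal n
  obtain ⟨E₁, hE₁, hE₁'⟩ := EReal.exists_rat_btwn_of_lt (max_lt hgap hlam)
  obtain ⟨E₂, hE₂, hE₂'⟩ := EReal.exists_rat_btwn_of_lt hE₁'
  obtain ⟨E₃, hE₃, hE₃'⟩ := EReal.exists_rat_btwn_of_lt hE₂'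
  have g1 := (le_max_left _ _).trans_lt hE₁
  have hl1 : lam < (E₁ : ℝ) := by exact_mod_cast (le_max_right _ _).trans_lt hE₁
  have h12 : (E₁ : ℝ) < (E₂ : ℝ) := by exact_mod_cast hE₂
  have h23 : (E₂ : ℝ) < (E₃ : ℝ) := by exact_mod_cast hE₃
  obtain ⟨-, r1⟩ := exists_analytic_spectral_projection h hR hl1 g1 hE₁'
  obtain ⟨han, -⟩ := exists_analytic_spectral_projection h hR (hl1.trans h12) (g1.trans hE₂) hE₂'
  obtain ⟨-, r3⟩ := exists_analytic_spectral_projection h hR ((hl1.trans h12).trans h23)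
    ((g1.trans hE₂).trans hE₃) hE₃'
  refine ⟨han.congr ?_, ?_⟩
  · filter_upwards [r1, r3] with k h1 h3
    simp only [lowProj, (h k).lowSpace_eigVal_eq ((eigVal_le_of_rank_eq _ h1).trans_lt hE₂)
      (hE₃.trans_le (le_eigVal_of_rank_eq _ h3))]
  · filter_upwards [r1, r3] with k h1 h3
    exact (eigVal_le_of_rank_eq _ h1).trans_lt
      ((hE₂.trans hE₃).trans_le (le_eigVal_of_rank_eq _ h3))

end Family

/-! ### Conical crossings along a line -/

section Conical

variable {𝓗 : Type*} [NormedAddCommGroup 𝓗] [InnerProductSpace ℂ 𝓗] [CompleteSpace 𝓗]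

theorem tendsto_clm_apply {ι : Type*} {l : Filter ι} {T : ι → (𝓗 →L[ℂ] 𝓗)} {T₀ : 𝓗 →L[ℂ] 𝓗}
    {w : ι → 𝓗} {w₀ : 𝓗} (hT : Tendsto T l (𝓝 T₀)) (hw : Tendsto w l (𝓝 w₀)) :
    Tendsto (fun t => T t (w t)) l (𝓝 (T₀ w₀)) :=
  ((isBoundedBilinearMap_apply (𝕜 := ℂ) (E := 𝓗) (F := 𝓗)).continuous.tendsto (T₀, w₀)).comp
    (hT.prodMk_nhds hw)

/-- The eigenvalue of a convergent family of eigenvectors, with non-zero limit, of a convergent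
family of operators converges. -/
theorem tendsto_eigenvalue {ι : Type*} {l : Filter ι} {T : ι → (𝓗 →L[ℂ] 𝓗)} {T₀ : 𝓗 →L[ℂ] 𝓗}
    {w : ι → 𝓗} {w₀ : 𝓗} {τ : ι → ℝ} (hT : Tendsto T l (𝓝 T₀)) (hw : Tendsto w l (𝓝 w₀))
    (hw₀ : w₀ ≠ 0) (h : ∀ᶠ t in l, T t (w t) = (τ t : ℂ) • w t) :
    Tendsto τ l (𝓝 ((inner ℂ w₀ (T₀ w₀)).re / ‖w₀‖ ^ 2)) := by
  have h1 : Tendsto (fun t => (inner ℂ (w t) (T t (w t))).re / ‖w t‖ ^ 2) l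
      (𝓝 ((inner ℂ w₀ (T₀ w₀)).re / ‖w₀‖ ^ 2)) := by
    apply Tendsto.div
    · exact (Complex.continuous_re.tendsto _).comp (hw.inner (tendsto_clm_apply hT hw))
    · exact hw.norm.pow 2
    · have := norm_pos_iff.2 hw₀
      positivity
  refine h1.congr' ?_
  filter_upwards [h, hw.eventually_ne hw₀] with t ht ht0
  have h2 : ‖w t‖ ^ 2 ≠ 0 := by
    have := norm_pos_iff.2 ht0
    positivity
  rw [ht, inner_smul_right, Complex.re_ofReal_mul, inner_self_eq_norm_sq_to_K]
  have : (((‖w t‖ : ℝ) : ℂ) ^ 2).re = ‖w t‖ ^ 2 := by norm_cast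
  simp only [Complex.coe_algebraMap]
  rw [this, mul_div_cancel_right₀ _ h2]

/-- Let `T` be continuous at `0` with exactly two eigenvalues `τ₁`, `τ₂` on the range of `Q`. If
`τ₂` has an eigenvector that stays away from `0`, then `τ₂ - τ₁` cannot jump from negative to
positive values at `0`. -/
theorem false_of_eigenvalues_jump {T Q : ℝ → (𝓗 →L[ℂ] 𝓗)} {T₀ Q₀ : 𝓗 →L[ℂ] 𝓗} {τ₁ τ₂ : ℝ → ℝ}
    {φ : ℝ → 𝓗} {φ₀ : 𝓗} {c : ℝ} (hc : 0 < c)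
    (hT : Tendsto T (𝓝[≠] 0) (𝓝 T₀)) (hQ : Tendsto Q (𝓝[≠] 0) (𝓝 Q₀))
    (hφ : Tendsto φ (𝓝[≠] 0) (𝓝 φ₀)) (hφ₀ : φ₀ ≠ 0)
    (h2 : ∀ᶠ t in 𝓝[≠] 0, T t (φ t) = (τ₂ t : ℂ) • φ t)
    (h1 : ∀ᶠ t in 𝓝[≠] 0, ∀ u, T t (T t (Q t u) - (τ₂ t : ℂ) • Q t u) =
      (τ₁ t : ℂ) • (T t (Q t u) - (τ₂ t : ℂ) • Q t u))
    (h0 : ∀ᶠ t in 𝓝[≠] 0, ∃ v, v ≠ 0 ∧ T t v = (τ₁ t : ℂ) • v ∧ Q t v = v)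
    (hpos : ∀ᶠ t in 𝓝[≠] (0 : ℝ), 0 < t → c ≤ τ₂ t - τ₁ t)
    (hneg : ∀ᶠ t in 𝓝[≠] (0 : ℝ), t < 0 → τ₂ t - τ₁ t ≤ -c) : False := by
  have hτ₂ := tendsto_eigenvalue hT hφ hφ₀ h2
  set t₂ := (inner ℂ φ₀ (T₀ φ₀)).re / ‖φ₀‖ ^ 2
  have hW : Tendsto (fun t => T t * Q t - ((τ₂ t : ℝ) : ℂ) • Q t) (𝓝[≠] 0)
      (𝓝 (T₀ * Q₀ - ((t₂ : ℝ) : ℂ) • Q₀)) :=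
    (hT.mul hQ).sub (((Complex.continuous_ofReal.tendsto _).comp hτ₂).smul hQ)
  by_cases hW₀ : T₀ * Q₀ - ((t₂ : ℝ) : ℂ) • Q₀ = 0
  · rw [hW₀] at hW
    have hW' := hW.norm
    rw [norm_zero] at hW'
    have hsmall := hW'.eventually_lt_const hc
    have hne : ∀ᶠ t in 𝓝[≠] (0 : ℝ), t ≠ 0 := self_mem_nhdsWithin
    obtain ⟨t, ht, ⟨v, hv0, hTv, hQv⟩, hp, hn, htne⟩ :=
      (hsmall.and (h0.and (hpos.and (hneg.and hne)))).exists
    have h3 := (T t * Q t - ((τ₂ t : ℝ) : ℂ) • Q t).le_opNorm v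
    have h4 : (T t * Q t - ((τ₂ t : ℝ) : ℂ) • Q t) v = ((τ₁ t - τ₂ t : ℝ) : ℂ) • v := by
      rw [sub_apply, mul_apply_eq_comp, smul_apply, hQv, hTv, Complex.ofReal_sub, sub_smul]
    rw [h4, norm_smul, Complex.norm_real, Real.norm_eq_abs] at h3
    have h5 := le_of_mul_le_mul_right h3 (norm_pos_iff.2 hv0)
    rcases lt_or_gt_of_ne htne with h6 | h6
    · have := hn h6
      have := le_abs_self (τ₁ t - τ₂ t)
      linarith
    · have := hp h6
      have := neg_le_abs (τ₁ t - τ₂ t)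
      linarith
  · obtain ⟨y, hy⟩ : ∃ y, (T₀ * Q₀ - ((t₂ : ℝ) : ℂ) • Q₀) y ≠ 0 := by
      by_contra! hcon
      exact hW₀ (ContinuousLinearMap.ext hcon)
    have hτ₁ := tendsto_eigenvalue (τ := τ₁) hT (tendsto_clm_apply hW tendsto_const_nhds) hy
      (h1.mono fun t ht => ht y)
    set t₁ := _
    have hd : Tendsto (fun t => τ₂ t - τ₁ t) (𝓝[≠] 0) (𝓝 (t₂ - t₁)) := hτ₂.sub hτ₁
    have hgt : 𝓝[>] (0 : ℝ) ≤ 𝓝[≠] 0 := nhdsWithin_mono _ fun t ht => ne_of_gt ht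
    have hlt : 𝓝[<] (0 : ℝ) ≤ 𝓝[≠] 0 := nhdsWithin_mono _ fun t ht => ne_of_lt ht
    have a1 : c ≤ t₂ - t₁ := by
      refine ge_of_tendsto (hd.mono_left hgt) ?_
      filter_upwards [hgt hpos, self_mem_nhdsWithin] with t ht ht0 using ht ht0
    have a2 : t₂ - t₁ ≤ -c := by
      refine le_of_tendsto (hd.mono_left hlt) ?_
      filter_upwards [hlt hneg, self_mem_nhdsWithin] with t ht ht0 using ht ht0
    linarith

theorem HasPurePointResolvent.exists_eigVal_eq {A : 𝓗 →ₗ.[ℂ] 𝓗} {lam : ℝ} {R : 𝓗 →L[ℂ] 𝓗}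
    (h : HasPurePointResolvent A lam R) {n : ℕ} {E : EReal} (hE : eigVal A (n + 1) < E) :
    ∃ e : ℝ, lam < e ∧ eigVal A (n + 1) = e := by
  have h1 := h.lam_lt_eigVal n
  have h2 : eigVal A (n + 1) = ((eigVal A (n + 1)).toReal : EReal) :=
    (EReal.coe_toReal (hE.trans_le le_top).ne ((bot_le.trans_lt h1).ne')).symm
  refine ⟨_, ?_, h2⟩
  rw [h2] at h1
  exact_mod_cast h1

theorem HasPurePointResolvent.lowProj_sub_apply_of_mem {A : 𝓗 →ₗ.[ℂ] 𝓗} {lam : ℝ}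
    {R : 𝓗 →L[ℂ] 𝓗} (h : HasPurePointResolvent A lam R) {m l : ℕ} {e : ℝ} {v : 𝓗}
    (hv : v ∈ eigSpace A e) (hm : eigVal A m < e) (hl : (e : EReal) ≤ eigVal A l) :
    (lowProj A l - lowProj A m) v = v := by
  rw [sub_apply, lowProj_apply_of_le hv hl, h.lowProj_apply_of_lt hv hm, sub_zero]

/-- Between two consecutive gaps there is an eigenvector. -/
theorem HasPurePointResolvent.exists_lowProj_sub_ne_zero {A : 𝓗 →ₗ.[ℂ] 𝓗} {lam : ℝ}
    {R : 𝓗 →L[ℂ] 𝓗} (h : HasPurePointResolvent A lam R) {m : ℕ}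
    (hm : eigVal A m < eigVal A (m + 1)) (hm' : eigVal A (m + 1) < eigVal A (m + 2)) :
    ∃ u, (lowProj A (m + 1) - lowProj A m) u ≠ 0 := by
  by_contra! hcon
  have h1 : lowProj A (m + 1) = lowProj A m := sub_eq_zero.1 (ContinuousLinearMap.ext hcon)
  have h2 := h.rank_range_lowProj hm
  rw [← h1, h.rank_range_lowProj (n := m + 1) hm', Nat.cast_inj] at h2
  omega

/-- Let the eigenvalues `m + 1` and `m + 2` cross conically at `t = 0`, away from the other
eigenvalues. An analytic curve of vectors which are, for `t ≠ 0`, in the eigenspace of the upper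
eigenvalue vanishes near `0`. Indeed, an analytic eigenvector must pass from the upper to
the lower branch at the crossing. -/
theorem eventually_eq_zero_of_mem_upper_eigSpace {A : ℝ → (𝓗 →ₗ.[ℂ] 𝓗)} {lam : ℝ}
    {R : ℝ → (𝓗 →L[ℂ] 𝓗)} (h : ∀ t, HasPurePointResolvent (A t) lam (R t))
    (hR : AnalyticAt ℝ R 0) {m : ℕ} (hcross : eigVal (A 0) (m + 1) = eigVal (A 0) (m + 2))
    (hlow : eigVal (A 0) m < eigVal (A 0) (m + 1))
    (hup : eigVal (A 0) (m + 2) < eigVal (A 0) (m + 3)) {c : ℝ} (hc : 0 < c)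
    (hcone : ∀ᶠ t in 𝓝 (0 : ℝ),
      eigVal (A t) (m + 1) + ((c * |t| : ℝ) : EReal) ≤ eigVal (A t) (m + 2))
    {Φ : ℝ → 𝓗} (hΦ : AnalyticAt ℝ Φ 0)
    (hΦe : ∀ᶠ t in 𝓝[≠] (0 : ℝ), ∀ e : ℝ, eigVal (A t) (m + 2) = e → Φ t ∈ eigSpace (A t) e) :
    ∀ᶠ t in 𝓝 0, Φ t = 0 := by
  by_contra hΦ0
  obtain ⟨j, φ, hφ, hφ0, hφeq⟩ := hΦ.exists_eventuallyEq_pow_smul_nonzero_iff.2 hΦ0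
  obtain ⟨hPm, hgm⟩ := analyticAt_lowProj h hR hlow
  obtain ⟨hPm2, hgm2⟩ := analyticAt_lowProj h hR (n := m + 2) hup
  obtain ⟨e₀, he₀, hee₀⟩ := (h 0).exists_eigVal_eq (n := m + 1) hup
  obtain ⟨d, hd⟩ : ∃ d, d = e₀ - lam := ⟨_, rfl⟩
  have hd0 : 0 < d := by linarith
  set Q : ℝ → (𝓗 →L[ℂ] 𝓗) := fun t => lowProj (A t) (m + 2) - lowProj (A t) m with hQ
  have hQan : AnalyticAt ℝ Q 0 := hPm2.sub hPm
  set Z : ℝ → (𝓗 →L[ℂ] 𝓗) := fun t => (1 - d • R t) * Q t with hZ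
  have hZan : AnalyticAt ℝ Z 0 :=
    (analyticAt_const.fun_sub (analyticAt_const.fun_smul hR)).fun_mul hQan
  have hZ0 : Z 0 = 0 := by
    ext u
    have h1 := (h 0).lowProj_sub_mem_eigSpace (m := m) (l := m + 2) hlow (hcross.trans hee₀) hee₀
      hup u
    rw [(h 0).mem_eigSpace, ← hd] at h1
    change (1 - d • R 0) (Q 0 u) = 0
    rw [sub_apply, one_apply_eq_self, smul_apply, sub_eq_zero]
    exact h1.symm
  set T : ℝ → (𝓗 →L[ℂ] 𝓗) := dslope Z 0 with hT
  have hTc : ContinuousAt T 0 := continuousAt_dslope_same.2 hZan.differentiableAt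
  have hTne : ∀ t, t ≠ 0 → T t = t⁻¹ • Z t := by
    intro t ht
    rw [hT, dslope_of_ne _ ht, slope_def_module, hZ0, sub_zero, sub_zero]
  -- the crossing eigenvalues are bounded by `lam + 2 d` near the crossing
  have hbd : ∀ᶠ t in 𝓝 (0 : ℝ), eigVal (A t) (m + 2) ≤ ((lam + 2 * d : ℝ) : EReal) := by
    have h1 : eigVal (A 0) (m + 2) < min (eigVal (A 0) (m + 3)) ((lam + 2 * d : ℝ) : EReal) := by
      refine lt_min hup ?_
      rw [hee₀, EReal.coe_lt_coe_iff]
      linarith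
    obtain ⟨E, hE, hE'⟩ := EReal.exists_rat_btwn_of_lt h1
    have h2 : lam < (E : ℝ) := by
      rw [hee₀] at hE
      exact he₀.trans (by exact_mod_cast hE)
    filter_upwards [(exists_analytic_spectral_projection h hR (n := m + 2) h2 hE
      (hE'.trans_le (min_le_left _ _))).2] with t ht
    exact (eigVal_le_of_rank_eq _ ht).trans (hE'.le.trans (min_le_right _ _))
  set τ₁ : ℝ → ℝ := fun t => t⁻¹ * (1 - d / ((eigVal (A t) (m + 1)).toReal - lam)) with hτ₁
  set τ₂ : ℝ → ℝ := fun t => t⁻¹ * (1 - d / ((eigVal (A t) (m + 2)).toReal - lam)) with hτ₂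
  have hTv : ∀ t, t ≠ 0 → ∀ (e : ℝ) (v : 𝓗), lam < e → v ∈ eigSpace (A t) e → Q t v = v →
      T t v = ((t⁻¹ * (1 - d / (e - lam)) : ℝ) : ℂ) • v := by
    intro t ht e v he hv hQv
    rw [hTne t ht, smul_apply]
    change t⁻¹ • ((1 - d • R t) (Q t v)) = _
    rw [hQv, sub_apply, one_apply_eq_self, smul_apply, (h t).apply_eq he.ne' hv,
      Complex.ofReal_mul, mul_smul]
    congr 1
    rw [Complex.ofReal_sub, sub_smul, Complex.ofReal_one, one_smul]
    congr 1
    rw [show d / (e - lam) = d * (1 / (e - lam)) from div_eq_mul_one_div _ _,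
      Complex.ofReal_mul, mul_smul]
    rfl
  -- all properties needed at a given `t ≠ 0`
  have main : ∀ᶠ t in 𝓝[≠] (0 : ℝ), t ≠ 0 ∧ ∃ e₁ e₂ : ℝ, lam < e₁ ∧ lam < e₂ ∧
      e₂ ≤ lam + 2 * d ∧ e₁ + c * |t| ≤ e₂ ∧ eigVal (A t) (m + 1) = e₁ ∧
      eigVal (A t) (m + 2) = e₂ ∧ eigVal (A t) m < e₁ ∧ e₂ < eigVal (A t) (m + 3) := by
    have hne : ∀ᶠ t in 𝓝[≠] (0 : ℝ), t ≠ 0 := self_mem_nhdsWithin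
    filter_upwards [hne, hgm.filter_mono nhdsWithin_le_nhds, hgm2.filter_mono nhdsWithin_le_nhds,
      hbd.filter_mono nhdsWithin_le_nhds, hcone.filter_mono nhdsWithin_le_nhds]
      with t ht h1 h2 h3 h4
    obtain ⟨e₂, he₂, hee₂⟩ := (h t).exists_eigVal_eq (n := m + 1) h2
    obtain ⟨e₁, he₁, hee₁⟩ := (h t).exists_eigVal_eq (n := m)
      ((eigVal_mono (A t) (by omega : m + 1 ≤ m + 2)).trans_lt h2)
    have hee₂' : eigVal (A t) (m + 2) = e₂ := hee₂
    rw [hee₁] at h1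
    rw [hee₂'] at h3
    rw [hee₁, hee₂'] at h4
    refine ⟨ht, e₁, e₂, he₁, he₂, by exact_mod_cast h3, by exact_mod_cast h4, hee₁, hee₂', h1, ?_⟩
    rw [← hee₂']
    exact h2
  refine false_of_eigenvalues_jump (T := T) (Q := Q) (τ₁ := τ₁) (τ₂ := τ₂) (φ := φ)
    (c := c / (4 * d)) (by positivity) (hTc.tendsto.mono_left nhdsWithin_le_nhds)
    (hQan.continuousAt.tendsto.mono_left nhdsWithin_le_nhds)
    (hφ.continuousAt.tendsto.mono_left nhdsWithin_le_nhds) hφ0 ?_ ?_ ?_ ?_ ?_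
  · filter_upwards [main, hΦe, hφeq.filter_mono nhdsWithin_le_nhds] with t ht ht1 ht2
    obtain ⟨htne, e₁, e₂, he₁, he₂, -, h4, hee₁, hee₂, h5, h6⟩ := ht
    have hφmem : φ t ∈ eigSpace (A t) e₂ := by
      have h7 := ht1 e₂ hee₂
      rw [ht2, sub_zero] at h7
      have h8 : ((t ^ j : ℝ) : ℂ) ≠ 0 := by exact_mod_cast pow_ne_zero j htne
      have h9 := Submodule.smul_mem _ ((t ^ j : ℝ) : ℂ)⁻¹ h7
      rwa [show t ^ j • φ t = ((t ^ j : ℝ) : ℂ) • φ t from rfl, smul_smul, inv_mul_cancel₀ h8,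
        one_smul] at h9
    have h10 := hTv t htne e₂ (φ t) he₂ hφmem
      ((h t).lowProj_sub_apply_of_mem hφmem (h5.trans_le ?_) hee₂.ge)
    · simp only [hτ₂, hee₂, EReal.toReal_coe]
      exact h10
    · rw [EReal.coe_le_coe_iff]
      have : 0 ≤ c * |t| := by positivity
      linarith
  · filter_upwards [main] with t ht u
    obtain ⟨htne, e₁, e₂, he₁, he₂, -, h4, hee₁, hee₂, h5, h6⟩ := ht
    have h12 : e₁ < e₂ := by
      have : 0 < c * |t| := by positivity
      linarith
    have h12' : eigVal (A t) (m + 1) < eigVal (A t) (m + 2) := by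
      rw [hee₁, hee₂]; exact_mod_cast h12
    have hb := (h t).lowProj_sub_mem_eigSpace (m := m) (l := m + 1) (hee₁ ▸ h5) hee₁ hee₁ h12' u
    have ha := (h t).lowProj_sub_mem_eigSpace (m := m + 1) (l := m + 2) h12' hee₂ hee₂
      (by rw [hee₂]; exact h6) u
    set b := (lowProj (A t) (m + 1) - lowProj (A t) m) u
    set a := (lowProj (A t) (m + 2) - lowProj (A t) (m + 1)) u
    have hab : Q t u = a + b := by
      simp only [hQ, a, b, sub_apply]
      abel
    have hTa := hTv t htne e₂ a he₂ ha
      ((h t).lowProj_sub_apply_of_mem ha (h5.trans_le (by exact_mod_cast h12.le)) hee₂.ge)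
    have hTb := hTv t htne e₁ b he₁ hb
      ((h t).lowProj_sub_apply_of_mem hb h5 (by rw [hee₂]; exact_mod_cast h12.le))
    simp only [hτ₁, hτ₂, hee₁, hee₂, EReal.toReal_coe]
    set z₁ : ℂ := ((t⁻¹ * (1 - d / (e₁ - lam)) : ℝ) : ℂ)
    set z₂ : ℂ := ((t⁻¹ * (1 - d / (e₂ - lam)) : ℝ) : ℂ)
    have h7 : T t (Q t u) - z₂ • Q t u = (z₁ - z₂) • b := by
      rw [hab, map_add, hTa, hTb, smul_add, sub_smul]
      abel
    rw [h7, map_smul, hTb, smul_comm]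
  · filter_upwards [main] with t ht
    obtain ⟨htne, e₁, e₂, he₁, he₂, -, h4, hee₁, hee₂, h5, h6⟩ := ht
    have h12 : e₁ < e₂ := by
      have : 0 < c * |t| := by positivity
      linarith
    have h12' : eigVal (A t) (m + 1) < eigVal (A t) (m + 2) := by
      rw [hee₁, hee₂]; exact_mod_cast h12
    have hm' : eigVal (A t) m < eigVal (A t) (m + 1) := hee₁ ▸ h5
    obtain ⟨u, hu⟩ := (h t).exists_lowProj_sub_ne_zero hm' h12'
    have hb := (h t).lowProj_sub_mem_eigSpace (m := m) (l := m + 1) hm' hee₁ hee₁ h12' u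
    have hQb := (h t).lowProj_sub_apply_of_mem (l := m + 2) hb h5
      (by rw [hee₂]; exact_mod_cast h12.le)
    refine ⟨_, hu, ?_, hQb⟩
    simp only [hτ₁, hee₁, EReal.toReal_coe]
    exact hTv t htne e₁ _ he₁ hb hQb
  all_goals
    filter_upwards [main] with t ht ht0
    obtain ⟨htne, e₁, e₂, he₁, he₂, h3, h4, hee₁, hee₂, h5, h6⟩ := ht
    simp only [hτ₁, hτ₂, hee₁, hee₂, EReal.toReal_coe]
    rw [← mul_sub]
    have hkey : c / (4 * d) * |t| ≤ (1 - d / (e₂ - lam)) - (1 - d / (e₁ - lam)) := by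
      have p1 : 0 < e₁ - lam := by linarith
      have p2 : 0 < e₂ - lam := by linarith
      have e : (1 - d / (e₂ - lam)) - (1 - d / (e₁ - lam)) =
          d * (e₂ - e₁) / ((e₁ - lam) * (e₂ - lam)) := by
        field_simp
        ring
      have h12 : c * |t| ≤ e₂ - e₁ := by linarith
      have hct : 0 ≤ c * |t| := by positivity
      have hprod : (e₁ - lam) * (e₂ - lam) ≤ (2 * d) * (2 * d) := by
        apply mul_le_mul <;> linarith
      rw [e, le_div_iff₀ (by positivity)]
      calc c / (4 * d) * |t| * ((e₁ - lam) * (e₂ - lam))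
          ≤ c / (4 * d) * |t| * ((2 * d) * (2 * d)) := by gcongr
        _ = d * (c * |t|) := by field_simp; ring
        _ ≤ d * (e₂ - e₁) := by gcongr
  · rw [abs_of_pos ht0] at hkey
    rw [le_inv_mul_iff₀ ht0]
    linarith
  · rw [abs_of_neg ht0] at hkey
    have h7 : t⁻¹ < 0 := inv_lt_zero.2 ht0
    calc _ ≤ t⁻¹ * (c / (4 * d) * -t) := mul_le_mul_of_nonpos_left hkey h7.le
      _ = _ := by field_simp

end Conical

/-! ### Complements of curves in `ℝ³` are connected -/

section Curves

/-- The cone with apex `a` over a `C¹` arc in `ℝ³` is two-dimensional. -/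
theorem dimH_cone_le (a : KSpace) {γ : ℝ → KSpace} (hγ : ContDiffOn ℝ 1 γ (Set.Icc 0 1)) :
    dimH ((fun z : ℝ × ℝ => a + z.1 • (γ z.2 - a)) '' (Set.univ ×ˢ Set.Icc 0 1)) ≤ 2 := by
  have h1 : ContDiffOn ℝ 1 (fun z : ℝ × ℝ => a + z.1 • (γ z.2 - a))
      (Set.univ ×ˢ Set.Icc 0 1) := by
    have h2 : ContDiffOn ℝ 1 (fun z : ℝ × ℝ => γ z.2) (Set.univ ×ˢ Set.Icc 0 1) :=
      hγ.comp contDiff_snd.contDiffOn (fun z hz => hz.2)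
    exact contDiffOn_const.add (contDiff_fst.contDiffOn.smul (h2.sub contDiffOn_const))
  refine (h1.dimH_image_le (convex_univ.prod (convex_Icc 0 1)) subset_rfl).trans ?_
  refine (dimH_mono (Set.subset_univ _)).trans ?_
  rw [Real.dimH_univ_eq_finrank]
  simp

/-- The complement of a countable union of `C¹` arcs in `ℝ³` is connected: for almost all `c`,
the segments from `c` to two given points of the complement avoid the arcs. -/
theorem isPreconnected_compl_iUnion_arcs {ι : Type*} [Countable ι] {γ : ι → ℝ → KSpace}
    (hγ : ∀ i, ContDiffOn ℝ 1 (γ i) (Set.Icc 0 1)) :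
    IsPreconnected (⋃ i, γ i '' Set.Icc 0 1)ᶜ := by
  set K := ⋃ i, γ i '' Set.Icc 0 1 with hK
  set cone : KSpace → Set KSpace := fun a =>
    ⋃ i, (fun z : ℝ × ℝ => a + z.1 • (γ i z.2 - a)) '' (Set.univ ×ˢ Set.Icc 0 1) with hcone
  have hseg : ∀ a c, a ∉ K → c ∉ cone a → segment ℝ a c ⊆ Kᶜ := by
    intro a c ha hc x hx hxK
    rw [segment_eq_image'] at hx
    obtain ⟨θ, hθ, rfl⟩ := hx
    rcases eq_or_ne θ 0 with rfl | hθ0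
    · apply ha
      simpa using hxK
    obtain ⟨i, hi⟩ := Set.mem_iUnion.1 hxK
    obtain ⟨s, hs, hs'⟩ := hi
    apply hc
    refine Set.mem_iUnion.2 ⟨i, ⟨(θ⁻¹, s), ⟨Set.mem_univ _, hs⟩, ?_⟩⟩
    simp only [hs']
    rw [add_sub_cancel_left, smul_smul, inv_mul_cancel₀ hθ0, one_smul, add_sub_cancel]
  apply isPreconnected_of_forall_pair
  intro a ha b hb
  have hdim : dimH (cone a ∪ cone b) < Module.finrank ℝ KSpace := by
    have : dimH (cone a ∪ cone b) ≤ 2 := by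
      rw [dimH_union, hcone]
      simp only [dimH_iUnion]
      exact max_le (iSup_le fun i => dimH_cone_le a (hγ i)) (iSup_le fun i => dimH_cone_le b (hγ i))
    refine this.trans_lt ?_
    rw [finrank_euclideanSpace_fin]
    norm_num
  obtain ⟨c, hc⟩ := (dense_compl_of_dimH_lt_finrank hdim).nonempty
  have hca : c ∉ cone a := fun h => hc (Or.inl h)
  have hcb : c ∉ cone b := fun h => hc (Or.inr h)
  refine ⟨segment ℝ a c ∪ segment ℝ b c, Set.union_subset (hseg a c ha hca) (hseg b c hb hcb),
    Or.inl (left_mem_segment ℝ a c), Or.inr (left_mem_segment ℝ b c), ?_⟩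
  exact IsPreconnected.union c (right_mem_segment ℝ a c) (right_mem_segment ℝ b c)
    (convex_segment a c).isPreconnected (convex_segment b c).isPreconnected

theorem IsFinitePointsAndCurves.isPreconnected_compl {K : Set KSpace}
    (hK : IsFinitePointsAndCurves K) : IsPreconnected Kᶜ := by
  obtain ⟨F, m, γ, hγ, rfl⟩ := hK
  -- a point is regarded as a constant arc
  let Γ : (Fin 3 → ℤ) × (F ⊕ Fin m) → ℝ → KSpace := fun p s =>
    Sum.elim (fun x : F => (x : KSpace)) (fun i => γ i s) p.2 + latticeVec p.1
  have hΓ : ∀ p, ContDiffOn ℝ 1 (Γ p) (Set.Icc 0 1) := by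
    rintro ⟨g, x | i⟩
    · change ContDiffOn ℝ 1 (fun _ : ℝ => (x : KSpace) + latticeVec g) _
      exact contDiffOn_const
    · have h1 : ContDiffOn ℝ 1 (γ i) (Set.Icc 0 1) := (hγ i).of_le (by exact_mod_cast le_top)
      exact h1.add (contDiffOn_const (c := latticeVec g))
  convert isPreconnected_compl_iUnion_arcs hΓ using 2
  ext k
  simp only [Set.mem_iUnion, Set.mem_image, Set.mem_union]
  constructor
  · rintro ⟨g, y, hy | ⟨i, s, hs, rfl⟩, rfl⟩
    · exact ⟨(g, Sum.inl ⟨y, hy⟩), 0, by simp, rfl⟩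
    · exact ⟨(g, Sum.inr i), s, hs, rfl⟩
  · rintro ⟨⟨g, x | i⟩, s, hs, rfl⟩
    · exact ⟨g, x, Or.inl x.2, rfl⟩
    · exact ⟨g, γ i s, Or.inr ⟨i, s, hs, rfl⟩, rfl⟩

end Curves

/-! ### Analyticity of Bloch transforms -/

section PowerSeries

variable {E F : Type*} [NormedAddCommGroup E] [NormedSpace ℝ E] [NormedAddCommGroup F]
  [NormedSpace ℝ F] [CompleteSpace F]

theorem tsum_multilinear_apply_const {ι : Type*} {n : ℕ} {q : ι → E [×n]→L[ℝ] F}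
    (hq : Summable q) (y : E) : (∑' i, q i) (fun _ => y) = ∑' i, q i fun _ => y :=
  ContinuousMultilinearMap.tsum_eval hq _

/-- A sum of analytic functions whose power series are summable in a common ball is analytic. -/
theorem analyticAt_tsum_of_summable {ι : Type*} {f : ι → E → F}
    {p : ι → FormalMultilinearSeries ℝ E F} {x : E} {r : ℝ} (hr : 0 < r)
    (hs : Summable fun q : ι × ℕ => ‖p q.1 q.2‖ * r ^ q.2)
    (hf : ∀ i y, ‖y‖ < r → HasSum (fun n => p i n fun _ => y) (f i (x + y))) :
    AnalyticAt ℝ (fun y => ∑' i, f i y) x := by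
  lift r to NNReal using hr.le
  have hsi : ∀ n, Summable fun i => ‖p i n‖ := by
    intro n
    have h1 : Summable fun i => ‖p i n‖ * (r : ℝ) ^ n :=
      hs.comp_injective (i := fun i => (i, n)) (fun i j h => (Prod.ext_iff.1 h).1)
    have h2 : (r : ℝ) ^ n ≠ 0 := pow_ne_zero _ hr.ne'
    exact (summable_mul_right_iff h2).1 h1
  have hsp : ∀ n, Summable fun i => p i n := fun n => Summable.of_norm (hsi n)
  have hsn : Summable fun n => ‖∑' i, p i n‖ * (r : ℝ) ^ n := by
    have h1 : Summable fun n => ∑' i, ‖p i n‖ * (r : ℝ) ^ n :=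
      ((Equiv.prodComm ℕ ι).summable_iff.2 hs).prod
    refine h1.of_nonneg_of_le (fun n => by positivity) fun n => ?_
    rw [tsum_mul_right]
    gcongr
    exact norm_tsum_le_tsum_norm (hsi n)
  refine ⟨fun n => ∑' i, p i n, r, ?_, ENNReal.coe_pos.2 (by exact_mod_cast hr), ?_⟩
  · exact FormalMultilinearSeries.le_radius_of_summable _ hsn
  · intro y hy
    have hy' : ‖y‖ < r := by
      rw [Metric.mem_eball, edist_zero_right] at hy
      exact_mod_cast (show ‖y‖ₑ < r from hy)
    have hle : ∀ i n, ‖p i n fun _ => y‖ ≤ ‖p i n‖ * (r : ℝ) ^ n := by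
      intro i n
      refine ((p i n).le_opNorm _).trans ?_
      rw [Finset.prod_const, Finset.card_univ, Fintype.card_fin]
      gcongr
    obtain ⟨a, ha⟩ : ∃ a : ι → ℕ → F, ∀ i n, a i n = p i n fun _ => y := ⟨_, fun _ _ => rfl⟩
    have hsum : Summable (Function.uncurry a) :=
      Summable.of_norm_bounded hs fun q => (congrArg norm (ha q.1 q.2)).trans_le (hle q.1 q.2)
    have hsum' : Summable fun q : ℕ × ι => a q.2 q.1 :=
      (Equiv.prodComm ℕ ι).summable_iff.2 hsum
    have e1 : ∀ n, (∑' i, p i n) (fun _ : Fin n => y) = ∑' i, a i n := fun n => by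
      rw [tsum_multilinear_apply_const (hsp n) y]
      exact tsum_congr fun i => (ha i n).symm
    have e2 : ∑' i, f i (x + y) = ∑' n, ∑' i, a i n := by
      rw [hsum.tsum_comm]
      refine tsum_congr fun i => ?_
      rw [← (hf i y hy').tsum_eq]
      exact tsum_congr fun n => (ha i n).symm
    rw [e2]
    exact (hsum'.prod.hasSum).congr_fun e1

end PowerSeries

section PlaneWave

variable {E 𝓗 : Type*} [NormedAddCommGroup E] [NormedSpace ℝ E] [NormedAddCommGroup 𝓗]
  [NormedSpace ℂ 𝓗]

/-- The power series of `y ↦ exp (L y) • w`. -/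
noncomputable def planeWaveSeries (L : E →L[ℝ] ℂ) (w : 𝓗) :
    FormalMultilinearSeries ℝ E 𝓗 := fun n =>
  ((ContinuousLinearMap.toSpanSingleton ℂ ((n.factorial : ℂ)⁻¹ • w)).restrictScalars
    ℝ).compContinuousMultilinearMap
      ((ContinuousMultilinearMap.mkPiAlgebraFin ℝ n ℂ).compContinuousLinearMap fun _ => L)

theorem planeWaveSeries_apply (L : E →L[ℝ] ℂ) (w : 𝓗) (n : ℕ) (m : Fin n → E) :
    planeWaveSeries L w n m = (∏ i, L (m i)) • (n.factorial : ℂ)⁻¹ • w := by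
  simp [planeWaveSeries, List.prod_ofFn]

theorem norm_planeWaveSeries_le (L : E →L[ℝ] ℂ) (w : 𝓗) (n : ℕ) :
    ‖planeWaveSeries L w n‖ ≤ ‖L‖ ^ n / n.factorial * ‖w‖ := by
  apply ContinuousMultilinearMap.opNorm_le_bound (by positivity)
  intro m
  rw [planeWaveSeries_apply, norm_smul, norm_smul, norm_prod, norm_inv, Complex.norm_natCast]
  have h1 : ∏ i, ‖L (m i)‖ ≤ ‖L‖ ^ n * ∏ i, ‖m i‖ := by
    calc ∏ i, ‖L (m i)‖ ≤ ∏ i, ‖L‖ * ‖m i‖ :=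
          Finset.prod_le_prod (fun i _ => norm_nonneg _) fun i _ => L.le_opNorm _
      _ = _ := by
          rw [Finset.prod_mul_distrib, Finset.prod_const, Finset.card_univ, Fintype.card_fin]
  calc (∏ i, ‖L (m i)‖) * ((n.factorial : ℝ)⁻¹ * ‖w‖)
      ≤ (‖L‖ ^ n * ∏ i, ‖m i‖) * ((n.factorial : ℝ)⁻¹ * ‖w‖) := by gcongr
    _ = _ := by rw [div_eq_mul_inv]; ring

theorem hasSum_planeWaveSeries (L : E →L[ℝ] ℂ) (w : 𝓗) (y : E) :
    HasSum (fun n => planeWaveSeries L w n fun _ => y) (Complex.exp (L y) • w) := by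
  have h1 := NormedSpace.exp_series_hasSum_exp' (𝕂 := ℂ) (L y)
  rw [← Complex.exp_eq_exp_ℂ] at h1
  refine (h1.smul_const w).congr_fun ?_
  intro n
  rw [planeWaveSeries_apply, Finset.prod_const, Finset.card_univ, Fintype.card_fin, smul_smul,
    smul_eq_mul, mul_comm]

end PlaneWave

section Lattice

theorem summable_exp_neg_mul_abs_int {b : ℝ} (hb : 0 < b) :
    Summable fun n : ℤ => Real.exp (-b * |(n : ℝ)|) := by
  have h : Summable fun n : ℕ => Real.exp (n * -b) := Real.summable_exp_nat_mul_iff.2 (by linarith)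
  apply Summable.of_nat_of_neg
  · refine h.congr fun n => ?_
    simp [mul_comm]
  · refine h.congr fun n => ?_
    simp [mul_comm]

theorem abs_le_norm_latticeVec (g : Fin 3 → ℤ) (i : Fin 3) : |(g i : ℝ)| ≤ ‖latticeVec g‖ := by
  have := PiLp.norm_apply_le (latticeVec g) i
  simpa [latticeVec] using this

theorem summable_exp_neg_mul_norm_latticeVec {b : ℝ} (hb : 0 < b) :
    Summable fun g : Fin 3 → ℤ => Real.exp (-b * ‖latticeVec g‖) := by
  classical
  have h1 := summable_exp_neg_mul_abs_int (b := b / 3) (by positivity)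
  have h2 : Summable fun g : Fin 3 → ℤ => ∏ i, Real.exp (-(b / 3) * |(g i : ℝ)|) := by
    refine summable_of_sum_le (c := ∏ _i : Fin 3, ∑' n : ℤ, Real.exp (-(b / 3) * |(n : ℝ)|))
      (fun g => by positivity) fun s => ?_
    have hsub : s ⊆ Fintype.piFinset fun i => s.image fun g => g i := by
      intro g hg
      rw [Fintype.mem_piFinset]
      exact fun i => Finset.mem_image_of_mem _ hg
    refine (Finset.sum_le_sum_of_subset_of_nonneg hsub fun g _ _ => by positivity).trans ?_
    rw [← Finset.prod_univ_sum (fun i => s.image fun g => g i)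
      (fun _ (n : ℤ) => Real.exp (-(b / 3) * |(n : ℝ)|))]
    exact Finset.prod_le_prod (fun i _ => by positivity) fun i _ =>
      h1.sum_le_tsum _ fun n _ => by positivity
  refine h2.of_nonneg_of_le (fun g => by positivity) fun g => ?_
  rw [← Real.exp_sum, Real.exp_le_exp, Fin.sum_univ_three]
  have := abs_le_norm_latticeVec g 0
  have := abs_le_norm_latticeVec g 1
  have := abs_le_norm_latticeVec g 2
  nlinarith

end Lattice

section Bloch

variable {𝓗 : Type*} [NormedAddCommGroup 𝓗] [InnerProductSpace ℂ 𝓗] [CompleteSpace 𝓗]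

/-- The phase `k ↦ 2 π i g · k` as a real-linear form. -/
noncomputable def latticePhase (g : Fin 3 → ℤ) : KSpace →L[ℝ] ℂ :=
  (2 * Real.pi * Complex.I) • Complex.ofRealCLM.comp (innerSL ℝ (latticeVec g))

theorem latticePhase_apply (g : Fin 3 → ℤ) (k : KSpace) :
    latticePhase g k = 2 * Real.pi * Complex.I * ((∑ i, (g i : ℝ) * k i : ℝ) : ℂ) := by
  have : inner ℝ (latticeVec g) k = ∑ i, (g i : ℝ) * k i := by
    rw [PiLp.inner_apply]
    apply Finset.sum_congr rfl
    intro i _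
    simp [latticeVec, mul_comm]
  rw [← this]
  simp [latticePhase]

theorem norm_latticePhase_le (g : Fin 3 → ℤ) :
    ‖latticePhase g‖ ≤ 2 * Real.pi * ‖latticeVec g‖ := by
  apply ContinuousLinearMap.opNorm_le_bound _ (by positivity)
  intro k
  have h1 : latticePhase g k = 2 * Real.pi * Complex.I * ((inner ℝ (latticeVec g) k : ℝ) : ℂ) := by
    simp [latticePhase]
  rw [h1, norm_mul, norm_mul, norm_mul, Complex.norm_I, Complex.norm_real, Complex.norm_real,
    Real.norm_of_nonneg Real.pi_pos.le, Complex.norm_ofNat, mul_one]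
  calc 2 * Real.pi * ‖inner ℝ (latticeVec g) k‖
      ≤ 2 * Real.pi * (‖latticeVec g‖ * ‖k‖) :=
        mul_le_mul_of_nonneg_left (norm_inner_le_norm (latticeVec g) k) (by positivity)
    _ = _ := (mul_assoc _ _ _).symm

theorem norm_exp_latticePhase (g : Fin 3 → ℤ) (k : KSpace) :
    ‖Complex.exp (latticePhase g k)‖ = 1 := by
  rw [latticePhase_apply, Complex.norm_exp]
  simp

theorem blochTransform_eq (w : (Fin 3 → ℤ) → 𝓗) (k : KSpace) :
    blochTransform w k = ∑' g, Complex.exp (latticePhase g k) • w g := by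
  simp only [blochTransform, latticePhase_apply]

theorem analyticAt_blochTransform {w : (Fin 3 → ℤ) → 𝓗} (hw : IsExpLocalised w) (k : KSpace) :
    AnalyticAt ℝ (blochTransform w) k := by
  obtain ⟨C, a, ha, hC⟩ := hw
  have hpi := Real.pi_pos
  set r : ℝ := a / (4 * Real.pi) with hr
  have hr0 : 0 < r := by positivity
  rw [funext (blochTransform_eq w)]
  refine analyticAt_tsum_of_summable
    (p := fun g => planeWaveSeries (latticePhase g) (Complex.exp (latticePhase g k) • w g))
    hr0 ?_ ?_
  · have hb : Summable fun q : (Fin 3 → ℤ) × ℕ =>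
        (‖latticePhase q.1‖ * r) ^ q.2 / q.2.factorial * ‖w q.1‖ := by
      rw [summable_prod_of_nonneg (fun q => by positivity)]
      have hexp : ∀ g : Fin 3 → ℤ, HasSum
          (fun n : ℕ => (‖latticePhase g‖ * r) ^ n / n.factorial * ‖w g‖)
          (Real.exp (‖latticePhase g‖ * r) * ‖w g‖) := by
        intro g
        have := NormedSpace.expSeries_div_hasSum_exp (‖latticePhase g‖ * r)
        rw [← Real.exp_eq_exp_ℝ] at this
        exact this.mul_right _
      refine ⟨fun g => (hexp g).summable, ?_⟩
      simp only [(hexp _).tsum_eq]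
      refine ((summable_exp_neg_mul_norm_latticeVec (b := a / 2) (by positivity)).mul_left
        C).of_nonneg_of_le (fun g => by positivity) fun g => ?_
      have h1 : ‖latticePhase g‖ * r ≤ a / 2 * ‖latticeVec g‖ := by
        calc ‖latticePhase g‖ * r ≤ 2 * Real.pi * ‖latticeVec g‖ * r := by
              gcongr; exact norm_latticePhase_le g
          _ = _ := by rw [hr]; field_simp; ring
      calc Real.exp (‖latticePhase g‖ * r) * ‖w g‖
          ≤ Real.exp (a / 2 * ‖latticeVec g‖) * (C * Real.exp (-a * ‖latticeVec g‖)) := by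
            gcongr; exact hC g
        _ = C * Real.exp (-(a / 2) * ‖latticeVec g‖) := by
            rw [mul_left_comm, ← Real.exp_add]
            congr 2
            ring
    refine hb.of_nonneg_of_le (fun q => by positivity) fun q => ?_
    have h1 := norm_planeWaveSeries_le (latticePhase q.1)
      (Complex.exp (latticePhase q.1 k) • w q.1) q.2
    rw [norm_smul, norm_exp_latticePhase, one_mul] at h1
    calc _ ≤ (‖latticePhase q.1‖ ^ q.2 / q.2.factorial * ‖w q.1‖) * r ^ q.2 := by gcongr
      _ = _ := by rw [mul_pow]; ring
  · intro g y _
    have := hasSum_planeWaveSeries (latticePhase g) (Complex.exp (latticePhase g k) • w g) y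
    rwa [smul_smul, ← Complex.exp_add, ← map_add, add_comm y k] at this

theorem isLatticePeriodic_blochTransform (w : (Fin 3 → ℤ) → 𝓗) :
    IsLatticePeriodic (blochTransform w) := by
  intro h k
  rw [blochTransform_eq, blochTransform_eq]
  refine tsum_congr fun g => ?_
  congr 1
  rw [map_add, Complex.exp_add]
  have : latticePhase g (latticeVec h) =
      ((∑ i, g i * h i : ℤ) : ℂ) * (2 * Real.pi * Complex.I) := by
    rw [latticePhase_apply]
    simp only [latticeVec]
    push_cast
    ring
  rw [this, Complex.exp_int_mul_two_pi_mul_I, mul_one]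

/-- The operator `x ↦ ⟨v, x⟩ w`, as a real-bilinear function of `v` and `w`. -/
noncomputable def rankOneBilin : 𝓗 →L[ℝ] 𝓗 →L[ℝ] (𝓗 →L[ℂ] 𝓗) :=
  LinearMap.mkContinuous₂
    (LinearMap.mk₂ ℝ (fun v w : 𝓗 => (innerSL ℂ v).smulRight w)
      (fun v v' w => by ext x; simp [add_smul])
      (fun c v w => by
        ext x
        change (inner ℂ (c • v) x : ℂ) • w = c • (inner ℂ v x : ℂ) • w
        rw [show c • v = (c : ℂ) • v from rfl, inner_smul_left, Complex.conj_ofReal, mul_smul]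
        rfl)
      (fun v w w' => by ext x; simp)
      (fun c v w => by ext x; exact smul_comm _ _ _)) 1
    (fun v w => by simp)

theorem topologicalClosure_span_range {n : ℕ} (φ : Fin n → 𝓗) :
    (Submodule.span ℂ (Set.range φ)).topologicalClosure = Submodule.span ℂ (Set.range φ) := by
  have := FiniteDimensional.span_of_finite ℂ (Set.finite_range φ)
  exact (Submodule.closed_of_finiteDimensional _).submodule_topologicalClosure_eq

theorem starProjection_span_eq_sum {n : ℕ} {φ : Fin n → 𝓗} (hφ : Orthonormal ℂ φ) :
    (Submodule.span ℂ (Set.range φ)).topologicalClosure.starProjection =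
      ∑ j, rankOneBilin (φ j) (φ j) := by
  ext x
  have hx : (∑ j, rankOneBilin (φ j) (φ j)) x = ∑ j, (inner ℂ (φ j) x : ℂ) • φ j := by
    rw [sum_apply]
    rfl
  rw [hx]
  apply Submodule.eq_starProjection_of_mem_of_inner_eq_zero
  · exact Submodule.le_topologicalClosure _ (Submodule.sum_mem _ fun j _ =>
      Submodule.smul_mem _ _ (Submodule.subset_span ⟨j, rfl⟩))
  · intro w hw
    rw [topologicalClosure_span_range] at hw
    have hle : Submodule.span ℂ (Set.range φ) ≤
        (ℂ ∙ (x - ∑ j, (inner ℂ (φ j) x : ℂ) • φ j))ᗮ := by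
      rw [Submodule.span_le]
      rintro _ ⟨i, rfl⟩
      rw [SetLike.mem_coe, Submodule.mem_orthogonal_singleton_iff_inner_left, inner_sub_right,
        hφ.inner_right_fintype, sub_self]
    exact Submodule.mem_orthogonal_singleton_iff_inner_right.1 (hle hw)

/-- The orthogonal projections onto the spans of an analytic orthonormal frame form an analytic
family. -/
theorem isAnalyticProjectorOn_of_orthonormal {n : ℕ} {φ : Fin n → KSpace → 𝓗}
    (hφ : ∀ j k, AnalyticAt ℝ (φ j) k) (ho : ∀ k, Orthonormal ℂ fun j => φ j k) :
    IsAnalyticProjectorOn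
      (fun k => (Submodule.span ℂ (Set.range fun j => φ j k)).topologicalClosure.starProjection) n
      Set.univ := by
  refine ⟨fun k _ => ?_, fun k _ => ⟨isStarProjection_starProjection, ?_⟩⟩
  · simp only [starProjection_span_eq_sum (ho _)]
    apply Finset.analyticAt_fun_sum
    intro j _
    have hb : AnalyticAt ℝ (fun p : 𝓗 × 𝓗 => rankOneBilin p.1 p.2) (φ j k, φ j k) :=
      (rankOneBilin (𝓗 := 𝓗)).analyticAt_bilinear _
    exact AnalyticAt.comp₂ hb (hφ j k) (hφ j k)
  · rw [Submodule.range_starProjection, topologicalClosure_span_range,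
      finrank_span_eq_card (ho k).linearIndependent, Fintype.card_fin]

end Bloch

/-! ### Analytic continuation from a Weyl point -/

section Projections

variable {𝓗 : Type*} [NormedAddCommGroup 𝓗] [InnerProductSpace ℂ 𝓗] [CompleteSpace 𝓗]

theorem range_le_range_iff_mul_eq {p q : 𝓗 →L[ℂ] 𝓗} (hp : IsStarProjection p)
    (hq : IsStarProjection q) : p.range ≤ q.range ↔ p * q = p := by
  have h1 : q * p = p ↔ p.range ≤ q.range := by
    constructor
    · rintro h _ ⟨x, rfl⟩
      exact ⟨p x, DFunLike.congr_fun h x⟩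
    · intro h
      ext x
      obtain ⟨y, hy⟩ := h ⟨x, rfl⟩
      change q y = p x at hy
      rw [mul_apply_eq_comp, ← hy]
      exact DFunLike.congr_fun hq.isIdempotentElem y
  rw [← h1]
  constructor <;> intro h <;> have := congrArg star h <;>
    rwa [star_mul, hp.isSelfAdjoint.star_eq, hq.isSelfAdjoint.star_eq] at this

theorem eq_of_range_le_of_finrank_eq {p q : 𝓗 →L[ℂ] 𝓗} (hp : IsStarProjection p)
    (hq : IsStarProjection q) (hle : p.range ≤ q.range) {n : ℕ} (hn : 0 < n)
    (hpn : Module.finrank ℂ p.range = n) (hqn : Module.finrank ℂ q.range = n) : p = q := by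
  have := Module.finite_of_finrank_pos (hqn ▸ hn)
  have heq : p.range = q.range := Submodule.eq_of_le_of_finrank_eq hle (hpn.trans hqn.symm)
  have h1 := (range_le_range_iff_mul_eq hp hq).1 heq.le
  have h2 := (range_le_range_iff_mul_eq hq hp).1 heq.ge
  have h3 := congrArg star h1
  rw [star_mul, hp.isSelfAdjoint.star_eq, hq.isSelfAdjoint.star_eq] at h3
  rw [← h3, h2]

end Projections

section Weyl

variable {𝓗 : Type*} [NormedAddCommGroup 𝓗] [InnerProductSpace ℂ 𝓗] [CompleteSpace 𝓗]
  {H : KSpace → (𝓗 →ₗ.[ℂ] 𝓗)}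

theorem IsAnalyticBlochFamily.exists_resolvent (hH : IsAnalyticBlochFamily H) :
    ∃ (lam : ℝ) (R : KSpace → (𝓗 →L[ℂ] 𝓗)), (∀ k, HasPurePointResolvent (H k) lam (R k)) ∧
      ∀ k, AnalyticAt ℝ R k := by
  obtain ⟨-, hsa, lam, R, hlow, hres, han, hb⟩ := hH
  exact ⟨lam, R, fun k => hasPurePointResolvent _ (hsa k) _ _ (hlow k) (hres k) (hb k),
    fun k => han k (Set.mem_univ k)⟩

theorem notMem_crossingSet_iff {n : ℕ} {k : KSpace} :
    k ∉ crossingSet H n ↔ eigVal (H k) n < eigVal (H k) (n + 1) :=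
  ⟨fun h => lt_of_le_of_ne (eigVal_mono _ n.le_succ) h, fun h => h.ne⟩

variable {lam : ℝ} {R : KSpace → (𝓗 →L[ℂ] 𝓗)}

theorem isOpen_compl_crossingSet (h : ∀ k, HasPurePointResolvent (H k) lam (R k))
    (hR : ∀ k, AnalyticAt ℝ R k) (n : ℕ) : IsOpen (crossingSet H n)ᶜ := by
  rw [isOpen_iff_eventually]
  intro k hk
  filter_upwards [(analyticAt_lowProj h (hR k) (notMem_crossingSet_iff.1 hk)).2] with k' hk'
  exact notMem_crossingSet_iff.2 hk'

theorem isAnalyticProjectorOn_lowProj (h : ∀ k, HasPurePointResolvent (H k) lam (R k))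
    (hR : ∀ k, AnalyticAt ℝ R k) (n : ℕ) :
    IsAnalyticProjectorOn (fun k => lowProj (H k) n) n (crossingSet H n)ᶜ := by
  refine ⟨fun k hk => (analyticAt_lowProj h (hR k) (notMem_crossingSet_iff.1 hk)).1,
    fun k hk => ⟨isStarProjection_lowProj _ _, ?_⟩⟩
  rw [Module.finrank, (h k).rank_range_lowProj (notMem_crossingSet_iff.1 hk),
    Cardinal.toNat_natCast]

/-- Near a Weyl point of `K_n` the bands `n + 1` and `n + 2` are separated, and so are, off this
point, the bands `n` and `n + 1`. -/
theorem IsWeylPoint.eventually_gaps (h : ∀ k, HasPurePointResolvent (H k) lam (R k))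
    (hR : ∀ k, AnalyticAt ℝ R k) {n : ℕ} {k₁ : KSpace} (hw : IsWeylPoint H n k₁) :
    (∀ᶠ k in 𝓝 k₁, k ∉ crossingSet H (n + 1)) ∧
      ∀ᶠ k in 𝓝[≠] k₁, k ∉ crossingSet H n := by
  obtain ⟨hn, hcross, hlow, hup, c, hc, hcone⟩ := hw
  have h1 : ∀ᶠ k in 𝓝 k₁, k ∉ crossingSet H (n + 1) :=
    (isOpen_compl_crossingSet h hR (n + 1)).mem_nhds (notMem_crossingSet_iff.2 hup)
  refine ⟨h1, ?_⟩
  have hne : ∀ᶠ k in 𝓝[≠] k₁, k ≠ k₁ := self_mem_nhdsWithin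
  filter_upwards [h1.filter_mono nhdsWithin_le_nhds, hcone.filter_mono nhdsWithin_le_nhds, hne]
    with k h2 h3 h4
  obtain ⟨e₂, -, he₂⟩ := (h k).exists_eigVal_eq (n := n) (notMem_crossingSet_iff.1 h2)
  obtain ⟨m, rfl⟩ := Nat.exists_eq_add_of_le' hn
  obtain ⟨e₁, -, he₁⟩ := (h k).exists_eigVal_eq (n := m)
    ((eigVal_mono (H k) (by omega : m + 1 ≤ m + 1 + 1)).trans_lt (notMem_crossingSet_iff.1 h2))
  rw [notMem_crossingSet_iff, he₁, he₂, EReal.coe_lt_coe_iff]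
  rw [he₁, he₂] at h3
  have h5 : e₁ + c * ‖k - k₁‖ ≤ e₂ := by exact_mod_cast h3
  have h6 : 0 < ‖k - k₁‖ := norm_pos_iff.2 (sub_ne_zero.2 h4)
  have : 0 < c * ‖k - k₁‖ := by positivity
  linarith

/-- Near a Weyl point there is no analytic vector field with values, off the Weyl point, in the
eigenspaces of the upper of the two crossing eigenvalues, except zero. -/
theorem IsWeylPoint.eqOn_zero (h : ∀ k, HasPurePointResolvent (H k) lam (R k))
    (hR : ∀ k, AnalyticAt ℝ R k) {n : ℕ} {k₁ : KSpace} (hw : IsWeylPoint H n k₁)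
    {Φ : KSpace → 𝓗} {ρ : ℝ} (hΦ : AnalyticOnNhd ℝ Φ (Metric.ball k₁ ρ))
    (hΦe : ∀ᶠ k in 𝓝[≠] k₁, ∀ e : ℝ, eigVal (H k) (n + 1) = e → Φ k ∈ eigSpace (H k) e) :
    ∀ k ∈ Metric.ball k₁ ρ, Φ k = 0 := by
  obtain ⟨hn, hcross, hlow, hup, c, hc, hcone⟩ := hw
  obtain ⟨m, rfl⟩ := Nat.exists_eq_add_of_le' hn
  intro k hk
  have hk₁ : k₁ ∈ Metric.ball k₁ ρ := Metric.mem_ball_self (Metric.pos_of_mem_ball hk)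
  have hℓan : ∀ (x : KSpace) (t : ℝ), AnalyticAt ℝ (fun t : ℝ => k₁ + t • x) t := fun x t =>
    analyticAt_const.fun_add (analyticAt_id.fun_smul analyticAt_const)
  -- `Φ` vanishes near `k₁` on every line through `k₁`
  have hzero : ∀ x : KSpace, x ≠ 0 → ∀ᶠ t in 𝓝 (0 : ℝ), Φ (k₁ + t • x) = 0 := by
    intro x hx0
    set ℓ : ℝ → KSpace := fun t => k₁ + t • x with hℓ
    have hℓ0 : ℓ 0 = k₁ := by simp [hℓ]
    have hℓtend : Tendsto ℓ (𝓝 0) (𝓝 k₁) := by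
      have := (hℓan x 0).continuousAt.tendsto
      simpa using this
    have hℓtend' : Tendsto ℓ (𝓝[≠] 0) (𝓝[≠] k₁) := by
      refine tendsto_nhdsWithin_iff.2 ⟨hℓtend.mono_left nhdsWithin_le_nhds, ?_⟩
      filter_upwards [self_mem_nhdsWithin] with t ht
      have : t • x ≠ 0 := smul_ne_zero ht hx0
      simpa [hℓ] using this
    refine eventually_eq_zero_of_mem_upper_eigSpace (A := fun t => H (ℓ t))
      (R := fun t => R (ℓ t)) (m := m) (c := c * ‖x‖) (fun t => h (ℓ t))
      ((hR _).fun_comp (hℓan x 0)) ?_ ?_ ?_ (by positivity) ?_ ?_ ?_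
    · rw [hℓ0]; exact hcross
    · rw [hℓ0]; exact hlow
    · rw [hℓ0]; exact hup
    · filter_upwards [hℓtend.eventually hcone] with t ht
      have : c * ‖x‖ * |t| = c * ‖ℓ t - k₁‖ := by
        simp only [hℓ, add_sub_cancel_left, norm_smul, Real.norm_eq_abs]
        ring
      rw [this]
      exact ht
    · exact AnalyticAt.fun_comp (by rw [zero_smul, add_zero]; exact hΦ _ hk₁) (hℓan x 0)
    · exact hℓtend'.eventually hΦe
  rcases eq_or_ne k k₁ with rfl | hkne
  · obtain ⟨x, hx⟩ := exists_ne (0 : KSpace)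
    simpa using (hzero x hx).self_of_nhds
  · have hseg : AnalyticOnNhd ℝ (fun t : ℝ => Φ (k₁ + t • (k - k₁))) (Set.Icc 0 1) := by
      intro t ht
      refine AnalyticAt.fun_comp (hΦ _ ?_) (hℓan _ t)
      rw [mem_ball_iff_norm] at hk ⊢
      simp only [add_sub_cancel_left, norm_smul, Real.norm_eq_abs, abs_of_nonneg ht.1]
      calc t * ‖k - k₁‖ ≤ 1 * ‖k - k₁‖ := by gcongr; exact ht.2
        _ < ρ := by rwa [one_mul]
    have := hseg.eqOn_zero_of_preconnected_of_eventuallyEq_zero isPreconnected_Icc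
      (by simp : (0 : ℝ) ∈ Set.Icc (0 : ℝ) 1) (hzero _ (sub_ne_zero.2 hkne))
      (by simp : (1 : ℝ) ∈ Set.Icc (0 : ℝ) 1)
    simpa using this

theorem analyticAt_apply_vector {F : KSpace → (𝓗 →L[ℂ] 𝓗)} {k : KSpace} (hF : AnalyticAt ℝ F k)
    (u : 𝓗) : AnalyticAt ℝ (fun k => F k u) k :=
  AnalyticAt.fun_comp (g := fun T : 𝓗 →L[ℂ] 𝓗 => T u)
    (((ContinuousLinearMap.apply ℂ 𝓗 u).restrictScalars ℝ).analyticAt _) hF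

/-- An analytic family of projectors of rank `n + 1` that contains `P_n` near a Weyl point of `K_n`
is equal to `P_{n+1}` near this point: the vectors `P_{n+1} (1 - P) u` are eigenvectors for the
upper of the two crossing eigenvalues. -/
theorem IsWeylPoint.eventually_eq_lowProj (h : ∀ k, HasPurePointResolvent (H k) lam (R k))
    (hR : ∀ k, AnalyticAt ℝ R k) {n : ℕ} {k₀ : KSpace} (hw : IsWeylPoint H n k₀)
    {U : Set KSpace} {P : KSpace → (𝓗 →L[ℂ] 𝓗)} (hU : U ∈ 𝓝 k₀)
    (hP : IsAnalyticProjectorOn P (n + 1) U)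
    (hle : ∀ᶠ k in 𝓝 k₀, k ∉ crossingSet H n → (lowProj (H k) n).range ≤ (P k).range) :
    ∀ᶠ k in 𝓝 k₀, P k = lowProj (H k) (n + 1) := by
  obtain ⟨hgap1, hgap⟩ := hw.eventually_gaps h hR
  obtain ⟨ρ, hρ, hball⟩ := Metric.eventually_nhds_iff_ball.1 (hgap1.and hU)
  have hL := isAnalyticProjectorOn_lowProj h hR (n + 1)
  refine Metric.eventually_nhds_iff_ball.2 ⟨ρ, hρ, fun k hk => ?_⟩
  have hzero : ∀ u, (lowProj (H k) (n + 1) * (1 - P k)) u = 0 := by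
    intro u
    refine hw.eqOn_zero h hR (Φ := fun k => (lowProj (H k) (n + 1) * (1 - P k)) u) (ρ := ρ)
      (fun k' hk' => ?_) ?_ k hk
    · exact analyticAt_apply_vector
        ((hL.1 k' (hball k' hk').1).fun_mul (analyticAt_const.fun_sub (hP.1 k' (hball k' hk').2))) u
    · filter_upwards [hgap, hgap1.filter_mono nhdsWithin_le_nhds,
        hle.filter_mono nhdsWithin_le_nhds, nhdsWithin_le_nhds hU] with k' h1 h2 h3 h4 e he
      have h5 := (range_le_range_iff_mul_eq (isStarProjection_lowProj (H k') n)
        (hP.2 k' h4).1).1 (h3 h1)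
      have h6 : lowProj (H k') (n + 1) * (1 - P k') =
          (lowProj (H k') (n + 1) - lowProj (H k') n) * (1 - P k') := by
        rw [sub_mul, mul_sub (lowProj (H k') n), h5, mul_one, sub_self, sub_zero]
      rw [h6]
      exact (h k').lowProj_sub_mem_eigSpace (notMem_crossingSet_iff.1 h1) he he
        (notMem_crossingSet_iff.1 h2) _
  have h1 : lowProj (H k) (n + 1) * P k = lowProj (H k) (n + 1) := by
    have h2 : lowProj (H k) (n + 1) * (1 - P k) = 0 := ContinuousLinearMap.ext hzero
    rw [mul_sub, mul_one, sub_eq_zero] at h2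
    exact h2.symm
  have hPk := hP.2 k (hball k hk).2
  have hLk := hL.2 k (hball k hk).1
  exact (eq_of_range_le_of_finrank_eq hLk.1 hPk.1
    ((range_le_range_iff_mul_eq hLk.1 hPk.1).2 h1) n.succ_pos hLk.2 hPk.2).symm

/-- The equality with `P_{n+1}` propagates to connected sets by analytic continuation. -/
theorem IsWeylPoint.eqOn_lowProj (h : ∀ k, HasPurePointResolvent (H k) lam (R k))
    (hR : ∀ k, AnalyticAt ℝ R k) {n : ℕ} {k₀ : KSpace} (hw : IsWeylPoint H n k₀)
    {U S : Set KSpace} {P : KSpace → (𝓗 →L[ℂ] 𝓗)} (hU : U ∈ 𝓝 k₀)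
    (hP : IsAnalyticProjectorOn P (n + 1) U)
    (hle : ∀ᶠ k in 𝓝 k₀, k ∉ crossingSet H n → (lowProj (H k) n).range ≤ (P k).range)
    (hS : IsPreconnected S) (hk₀ : k₀ ∈ S) (hSU : S ⊆ U) (hSK : S ⊆ (crossingSet H (n + 1))ᶜ) :
    ∀ k ∈ S, P k = lowProj (H k) (n + 1) :=
  (hP.1.mono hSU).eqOn_of_preconnected_of_eventuallyEq
    ((isAnalyticProjectorOn_lowProj h hR (n + 1)).1.mono hSK) hS hk₀
    (hw.eventually_eq_lowProj h hR hU hP hle)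

theorem IsWeylPoint.notMem_crossingSet_succ {n : ℕ} {k₀ : KSpace} (hw : IsWeylPoint H n k₀) :
    k₀ ∉ crossingSet H (n + 1) := notMem_crossingSet_iff.2 hw.2.2.2.1

/-- `P_n` has no analytic extension across a Weyl point of `K_n`: for such an extension `Q`, the
vectors `(P_{n+1} - Q) u` would be analytic eigenvectors for the upper eigenvalue. -/
theorem IsWeylPoint.isSingularCrossing (h : ∀ k, HasPurePointResolvent (H k) lam (R k))
    (hR : ∀ k, AnalyticAt ℝ R k) {n : ℕ} {k₁ : KSpace} (hw : IsWeylPoint H n k₁) :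
    IsSingularCrossing H n k₁ := by
  refine ⟨hw.2.1, ?_⟩
  rintro ⟨Q, hQ, hQe⟩
  obtain ⟨hgap1, hgap⟩ := hw.eventually_gaps h hR
  obtain ⟨ρ, hρ, hball⟩ := Metric.eventually_nhds_iff_ball.1 (hgap1.and hQ.eventually_analyticAt)
  have hL := isAnalyticProjectorOn_lowProj h hR (n + 1)
  have hzero : ∀ u, ∀ k ∈ Metric.ball k₁ ρ, (lowProj (H k) (n + 1) - Q k) u = 0 := by
    intro u
    refine hw.eqOn_zero h hR (Φ := fun k => (lowProj (H k) (n + 1) - Q k) u)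
      (fun k hk => ?_) ?_
    · exact analyticAt_apply_vector ((hL.1 k (hball k hk).1).fun_sub (hball k hk).2) u
    · filter_upwards [hgap, hgap1.filter_mono nhdsWithin_le_nhds,
        hQe.filter_mono nhdsWithin_le_nhds] with k h1 h2 h3 e he
      rw [h3 h1]
      exact (h k).lowProj_sub_mem_eigSpace (notMem_crossingSet_iff.1 h1) he he
        (notMem_crossingSet_iff.1 h2) _
  have := Module.punctured_nhds_neBot ℝ KSpace k₁
  obtain ⟨k, h1, h2, h3, h4⟩ := (hgap.and ((hgap1.filter_mono nhdsWithin_le_nhds).and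
    ((hQe.filter_mono nhdsWithin_le_nhds).and
      (nhdsWithin_le_nhds (Metric.ball_mem_nhds k₁ hρ))))).exists
  obtain ⟨u, hu⟩ := (h k).exists_lowProj_sub_ne_zero (notMem_crossingSet_iff.1 h1)
    (notMem_crossingSet_iff.1 h2)
  apply hu
  rw [← h3 h1]
  exact hzero u k h4

end Weyl

/-! ### Uniqueness and non-existence of the enlarged projector -/

theorem lemma4 {𝓗 : Type*} [NormedAddCommGroup 𝓗] [InnerProductSpace ℂ 𝓗] [CompleteSpace 𝓗]
    (H : KSpace → (𝓗 →ₗ.[ℂ] 𝓗)) (hH : IsAnalyticBlochFamily H)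
    (N : ℕ) (k₀ : KSpace) (hk₀ : IsWeylPoint H N k₀) :
    -- `P_{N+1}` is an analytic projector of rank `N + 1` off `K_{N+1}`, and it contains `P_N`
    (IsOpen (crossingSet H (N + 1))ᶜ ∧
      IsLatticePeriodic (fun k => lowProj (H k) (N + 1)) ∧
      IsAnalyticProjectorOn (fun k => lowProj (H k) (N + 1)) (N + 1) (crossingSet H (N + 1))ᶜ ∧
      ∀ k ∉ crossingSet H N, (lowProj (H k) N).range ≤ (lowProj (H k) (N + 1)).range) ∧
    -- local uniqueness
    (∀ (U : Set KSpace) (P : KSpace → (𝓗 →L[ℂ] 𝓗)), IsOpen U → k₀ ∈ U →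
      IsAnalyticProjectorOn P (N + 1) U →
      (∀ᶠ k in 𝓝 k₀, k ∉ crossingSet H N → (lowProj (H k) N).range ≤ (P k).range) →
      ∀ k ∈ connectedComponentIn (U \ crossingSet H (N + 1)) k₀, P k = lowProj (H k) (N + 1)) ∧
    (IsFinitePointsAndCurves (crossingSet H (N + 1)) →
      -- uniqueness on the Brillouin zone
      (∀ (P : KSpace → (𝓗 →L[ℂ] 𝓗)) (V : Set KSpace), IsLatticePeriodic P →
        IsAnalyticProjectorOn P (N + 1) Set.univ →
        IsOpen V → crossingSet H N ⊆ V →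
        (∀ k ∈ V, k ∉ crossingSet H N → (lowProj (H k) N).range ≤ (P k).range) →
        ∀ k ∉ crossingSet H (N + 1), P k = lowProj (H k) (N + 1)) ∧
      -- non-existence when `P_{N+1}` is singular somewhere
      ((∃ k₁, IsSingularCrossing H (N + 1) k₁) →
        (¬ ∃ P : KSpace → (𝓗 →L[ℂ] 𝓗), IsLatticePeriodic P ∧
          IsAnalyticProjectorOn P (N + 1) Set.univ ∧
          ∀ k ∉ crossingSet H N, (lowProj (H k) N).range ≤ (P k).range) ∧
        ¬ ∃ w : Fin (N + 1) → (Fin 3 → ℤ) → 𝓗, (∀ j, IsExpLocalised (w j)) ∧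
          (∀ k, Orthonormal ℂ (fun j => blochTransform (w j) k)) ∧
          ∀ k ∉ crossingSet H N, (lowProj (H k) N).range ≤
            Submodule.span ℂ (Set.range (fun j => blochTransform (w j) k)))) ∧
    -- Weyl points between the bands `N + 1` and `N + 2` are singular
    (∀ k₁, IsWeylPoint H (N + 1) k₁ → IsSingularCrossing H (N + 1) k₁) := by
  obtain ⟨lam, R, h, hR⟩ := hH.exists_resolvent
  have hk₀K := hk₀.notMem_crossingSet_succ
  have hglobal : IsFinitePointsAndCurves (crossingSet H (N + 1)) →
      ∀ (P : KSpace → (𝓗 →L[ℂ] 𝓗)) (V : Set KSpace), IsAnalyticProjectorOn P (N + 1) Set.univ →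
        IsOpen V → crossingSet H N ⊆ V →
        (∀ k ∈ V, k ∉ crossingSet H N → (lowProj (H k) N).range ≤ (P k).range) →
        ∀ k ∉ crossingSet H (N + 1), P k = lowProj (H k) (N + 1) :=
    fun hK P V hP hV hKV hle =>
      hk₀.eqOn_lowProj h hR Filter.univ_mem hP
        ((hV.eventually_mem (hKV hk₀.2.1)).mono fun k hk => hle k hk)
        hK.isPreconnected_compl hk₀K (Set.subset_univ _) subset_rfl
  refine ⟨⟨isOpen_compl_crossingSet h hR _, fun g k => ?_, isAnalyticProjectorOn_lowProj h hR _,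
    fun k _ => range_lowProj_mono _ N.le_succ⟩, ?_, fun hK => ⟨?_, ?_⟩,
    fun k₁ hk₁ => hk₁.isSingularCrossing h hR⟩
  · exact congrArg (fun A => lowProj A (N + 1)) (hH.1 g k)
  · intro U P hU hk₀U hP hle
    have hsub := connectedComponentIn_subset (U \ crossingSet H (N + 1)) k₀
    exact hk₀.eqOn_lowProj h hR (hU.mem_nhds hk₀U) hP hle isPreconnected_connectedComponentIn
      (mem_connectedComponentIn ⟨hk₀U, hk₀K⟩) (fun k hk => (hsub hk).1) (fun k hk => (hsub hk).2)
  · exact fun P V _ hP hV hKV hle => hglobal hK P V hP hV hKV hle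
  · rintro ⟨k₁, -, hk₁⟩
    have hno : ¬ ∃ P : KSpace → (𝓗 →L[ℂ] 𝓗), IsLatticePeriodic P ∧
        IsAnalyticProjectorOn P (N + 1) Set.univ ∧
        ∀ k ∉ crossingSet H N, (lowProj (H k) N).range ≤ (P k).range := by
      rintro ⟨P, -, hP, hle⟩
      refine hk₁ ⟨P, hP.1 k₁ (Set.mem_univ _), Filter.Eventually.of_forall ?_⟩
      exact hglobal hK P Set.univ hP isOpen_univ (Set.subset_univ _) fun k _ => hle k
    refine ⟨hno, ?_⟩
    rintro ⟨w, hw, ho, hle⟩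
    refine hno ⟨_, fun g k => ?_, isAnalyticProjectorOn_of_orthonormal
      (φ := fun j => blochTransform (w j)) (fun j => analyticAt_blochTransform (hw j)) ho,
      fun k hk => ?_⟩
    · simp only [isLatticePeriodic_blochTransform (w _) g k]
    · rw [Submodule.range_starProjection, topologicalClosure_span_range]
      exact hle k hk
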